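/- Let $-1<q<1$. For a real Hilbert space $\mathcal H_{\mathbb R}$ with complexification $\mathcal H$, let $\mathcal F=\bigoplus_{n\ge 0}\mathcal H_q^{\otimes n}$ be the $q$-Fock space, where $\mathcal H_q^{\otimes 0}=\mathbb C\Omega$ with a unit vector $\Omega$ and $\mathcal H_q^{\otimes n}$ is the $n$-fold tensor product with the scalar product $$\langle \phi_1\otimes\cdots\otimes\phi_n,\ \psi_1\otimes\cdots\otimes\psi_n\rangle_q=\sum_{\sigma\in S_n}q^{\operatorname{inv}\sigma}\prod_{i=1}^n\langle\phi_i,\psi_{\sigma(i)}\rangle ,$$ $\operatorname{inv}\sigma$ being the number of inversions of $\sigma$. For $\phi\in\mathcal H_{\mathbb R}$ let $l_\phi^*$ and $r_\phi^*$ be the bounded operators on $\mathcal F$ with $l^*_\phi(\psi_1\otimes\cdots\otimes\psi_n)=\phi\otimes\psi_1\otimes\cdots\otimes\psi_n$ and $r^*_\phi(\psi_1\otimes\cdots\otimes\psi_n)=\psi_1\otimes\cdots\otimes\psi_n\otimes\phi$, let $l_\phi,r_\phi$ be their adjoints, and put $L_\phi=l_\phi+l_\phi^*$, $R_\phi=r_\phi+r_\phi^*$.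 Let $\Gamma_q$ be the von Neumann algebra on $\mathcal F$ generated by $\{L_\phi:\phi\in\mathcal H_{\mathbb R}\}$. Call an integer $d_0\ge 0$ a gap constant for $q$ if for every real Hilbert space $\mathcal H_{\mathbb R}$, every $d\ge d_0$ and every orthonormal system $e_1,\dots,e_d$ in $\mathcal H_{\mathbb R}$ there is $\epsilon>0$ such that the operator $|M|=\big(\sum_{i=1}^d(L_{e_i}-R_{e_i})^2\big)^{1/2}$ satisfies $\langle x,|M|x\rangle\ge\epsilon\|x\|^2$ for all $x\in\mathcal F$ orthogonal to $\Omega$. **Theorem.** For every $-1<q<1$ a gap constant for $q$ exists. If $d_0$ is any gap constant for $q$ and $\mathcal H_{\mathbb R}$ is a real Hilbert space with $\dim\mathcal H_{\mathbb R}\ge d_0$ (infinite dimension allowed), then $\Gamma_q$ is a type $\mathrm{II}_1$ factor with faithful normal tracial state $\tau(x)=\langle\Omega,x\Omega\rangle$, and it does not have property $\Gamma$ of Murray and von Neumann: it is not true that for all $x_1,\dots,x_m\in\Gamma_q$ and all $\varepsilon>0$ there is a unitary $u\in\Gamma_q$ with $\tau(u)=0$ and $\|x_iu-ux_i\|_2<\varepsilon$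 for $i=1,\dots,m$, where $\|y\|_2=\tau(y^*y)^{1/2}$. -/

import Mathlib

open scoped InnerProductSpace ComplexConjugate

noncomputable section

namespace QGaussian

/-- The number of inversions of a permutation `σ` of `{0, …, n - 1}`. -/
def invCount {n : ℕ} (σ : Equiv.Perm (Fin n)) : ℕ :=
  (Finset.univ.filter fun p : Fin n × Fin n => p.1 < p.2 ∧ σ p.2 < σ p.1).card

/-- The `q`-inner product `⟨v₁ ⊗ ⋯ ⊗ vₙ, P⁽ⁿ⁾ (w₁ ⊗ ⋯ ⊗ wₙ)⟩` of two elementary tensors of real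
vectors, where `P⁽ⁿ⁾ (w₁ ⊗ ⋯ ⊗ wₙ) = ∑ σ, q ^ inv σ • w_{σ 1} ⊗ ⋯ ⊗ w_{σ n}`. -/
def tensorForm {H : Type*} [NormedAddCommGroup H] [InnerProductSpace ℝ H] (q : ℝ) {n : ℕ}
    (v w : Fin n → H) : ℝ :=
  ∑ σ : Equiv.Perm (Fin n), q ^ invCount σ * ∏ i, ⟪v i, w (σ i)⟫_ℝ

/-- Words `(v₁, …, vₙ)`, `n ≥ 0`, in the vectors of `H`; they name the elementary tensors
`v₁ ⊗ ⋯ ⊗ vₙ`. -/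
abbrev FockWord (H : Type*) : Type _ := (n : ℕ) × (Fin n → H)

/-- The `q`-inner product of two elementary tensors; tensors of different degree are
orthogonal. -/
def wordForm {H : Type*} [NormedAddCommGroup H] [InnerProductSpace ℝ H] (q : ℝ)
    (a b : FockWord H) : ℝ :=
  if h : a.1 = b.1 then tensorForm q a.2 (b.2 ∘ Fin.cast h) else 0

theorem wordForm_same {H : Type*} [NormedAddCommGroup H] [InnerProductSpace ℝ H] (q : ℝ) {n : ℕ}
    (v w : Fin n → H) : wordForm q ⟨n, v⟩ ⟨n, w⟩ = tensorForm q v w := by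
  simp [wordForm]

section Positivity

theorem psd_of_finset {α : Type*} {K : Matrix α α ℝ} (hs : ∀ i j, K i j = K j i)
    (h : ∀ (s : Finset α) (f : α → ℝ), 0 ≤ ∑ i ∈ s, ∑ j ∈ s, f i * K i j * f j) :
    K.PosSemidef :=
  ⟨by ext i j; simp [hs i j], fun x => by simpa [Finsupp.sum] using h x.support x⟩

theorem psd_finset {α : Type*} {K : Matrix α α ℝ} (hK : K.PosSemidef) (s : Finset α)
    (f : α → ℝ) : 0 ≤ ∑ i ∈ s, ∑ j ∈ s, f i * K i j * f j := by
  classical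
  have h := hK.2 (Finsupp.onFinset s (fun i => if i ∈ s then f i else 0) (by simp +contextual))
  rw [Finsupp.sum_of_support_subset (s := s) _ (by intro i; simp +contextual) _ (by simp)] at h
  refine h.trans_eq (Finset.sum_congr rfl fun i hi => ?_)
  rw [Finsupp.sum_of_support_subset (s := s) _ (by intro i; simp +contextual) _ (by simp)]
  refine Finset.sum_congr rfl fun j hj => ?_
  simp [hi, hj]

theorem psd_gram {α H : Type*} [NormedAddCommGroup H] [InnerProductSpace ℝ H] (v : α → H) :
    Matrix.PosSemidef (fun i j => ⟪v i, v j⟫_ℝ : Matrix α α ℝ) := by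
  refine psd_of_finset (fun i j => real_inner_comm _ _) fun s f => ?_
  have : ∑ i ∈ s, ∑ j ∈ s, f i * ⟪v i, v j⟫_ℝ * f j
      = ⟪∑ i ∈ s, f i • v i, ∑ i ∈ s, f i • v i⟫_ℝ := by
    simp only [sum_inner, inner_sum, real_inner_smul_left, real_inner_smul_right]
    refine Finset.sum_congr rfl fun i _ => Finset.sum_congr rfl fun j _ => ?_
    rw [real_inner_comm (v j) (v i)]; ring
  rw [this]
  exact real_inner_self_nonneg

theorem psd_one {α : Type*} : Matrix.PosSemidef (fun _ _ => 1 : Matrix α α ℝ) := by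
  simpa using psd_gram (fun _ : α => (1 : ℝ))

theorem psd_prod {α κ : Type*} (s : Finset κ) (K : κ → Matrix α α ℝ)
    (h : ∀ k, (K k).PosSemidef) :
    Matrix.PosSemidef (fun i j => ∏ k ∈ s, K k i j : Matrix α α ℝ) := by
  classical
  induction s using Finset.induction_on with
  | empty => simpa using psd_one
  | insert a s ha ih =>
    have e : (fun i j => ∏ k ∈ insert a s, K k i j : Matrix α α ℝ)
        = (K a).hadamard (fun i j => ∏ k ∈ s, K k i j) := by
      ext i j
      rw [Finset.prod_insert ha]; rfl
    rw [e]
    exact (h a).hadamard ih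

theorem psd_two {α : Type*} (q : ℝ) (h₁ : -1 ≤ q) (h₂ : q ≤ 1) (p : α → Prop)
    [DecidablePred p] :
    Matrix.PosSemidef (fun i j => if (p i ↔ p j) then 1 else q : Matrix α α ℝ) := by
  have A := (psd_one (α := α)).smul (a := (1 + q) / 2) (by linarith)
  have B := (psd_gram (fun i : α => if p i then (1 : ℝ) else -1)).smul (a := (1 - q) / 2)
    (by linarith)
  have e : (fun i j => if (p i ↔ p j) then 1 else q : Matrix α α ℝ)
      = ((1 + q) / 2) • (fun _ _ => 1 : Matrix α α ℝ) + ((1 - q) / 2) •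
        (fun i j => ⟪if p i then (1 : ℝ) else -1, if p j then (1 : ℝ) else -1⟫_ℝ :
          Matrix α α ℝ) := by
    ext i j
    change _ = (1 + q) / 2 * 1 + (1 - q) / 2 *
      ⟪if p i then (1 : ℝ) else -1, if p j then (1 : ℝ) else -1⟫_ℝ
    by_cases hi : p i <;> by_cases hj : p j <;> simp [hi, hj] <;> ring
  rw [e]
  exact A.add B

theorem psd_average {α β : Type*} [Fintype α] {K : Matrix (α × β) (α × β) ℝ}
    (hK : K.PosSemidef) :
    Matrix.PosSemidef (fun i j => ∑ a, ∑ b, K (a, i) (b, j) : Matrix β β ℝ) := by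
  refine psd_of_finset (fun i j => ?_) fun s f => ?_
  · rw [Finset.sum_comm]
    refine Finset.sum_congr rfl fun a _ => Finset.sum_congr rfl fun b _ => ?_
    simpa using (hK.1.apply (a, j) (b, i))
  · have := psd_finset hK (Finset.univ ×ˢ s) (fun p => f p.2)
    refine this.trans_eq ?_
    simp only [Finset.sum_product, Finset.mul_sum, Finset.sum_mul]
    rw [Finset.sum_comm]
    refine Finset.sum_congr rfl fun i _ => ?_
    conv_rhs => rw [Finset.sum_comm]
    refine Finset.sum_congr rfl fun a _ => ?_
    rw [Finset.sum_comm]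

theorem pow_invCount {n : ℕ} (q : ℝ) (σ : Equiv.Perm (Fin n)) :
    q ^ invCount σ = ∏ p : Fin n × Fin n, if p.1 < p.2 ∧ σ p.2 < σ p.1 then q else 1 := by
  rw [invCount, ← Finset.prod_const, Finset.prod_filter]

theorem pow_invCount_mul_inv {n : ℕ} (q : ℝ) (σ τ : Equiv.Perm (Fin n)) :
    q ^ invCount (τ * σ⁻¹) = ∏ p ∈ Finset.univ.filter (fun p : Fin n × Fin n => p.1 < p.2),
      if (σ p.1 < σ p.2 ↔ τ p.1 < τ p.2) then (1 : ℝ) else q := by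
  rw [pow_invCount, ← Finset.prod_subset (Finset.subset_univ
    (Finset.univ.filter (fun p : Fin n × Fin n => p.1 < p.2)))
    (by intro p _ hp; rw [if_neg]; rintro ⟨h, _⟩; exact hp (by simp [h]))]
  symm
  refine Finset.prod_bij'
    (fun p _ => if σ p.1 < σ p.2 then (σ p.1, σ p.2) else (σ p.2, σ p.1))
    (fun p _ => if σ⁻¹ p.1 < σ⁻¹ p.2 then (σ⁻¹ p.1, σ⁻¹ p.2) else (σ⁻¹ p.2, σ⁻¹ p.1))
    ?_ ?_ ?_ ?_ ?_
  · rintro ⟨a, b⟩ h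
    have hab : a < b := by simpa using h
    by_cases h1 : σ a < σ b
    · simp [h1]
    · have : σ b < σ a := lt_of_le_of_ne (not_lt.1 h1) (by simpa using hab.ne')
      simp [h1, this]
  · rintro ⟨a, b⟩ h
    have hab : a < b := by simpa using h
    by_cases h1 : σ⁻¹ a < σ⁻¹ b
    · rw [if_pos h1]; simpa using h1
    · have : σ⁻¹ b < σ⁻¹ a := lt_of_le_of_ne (not_lt.1 h1) (by simpa using hab.ne')
      rw [if_neg h1]; simpa using this
  · rintro ⟨a, b⟩ h
    have hab : a < b := by simpa using h
    by_cases h1 : σ a < σ b <;> simp [h1, hab, hab.le]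
  · rintro ⟨a, b⟩ h
    have hab : a < b := by simpa using h
    by_cases h1 : σ⁻¹ a < σ⁻¹ b
    · simp only [h1, if_true]; simp [hab]
    · simp only [h1, if_false]; simp [hab.not_gt]
  · rintro ⟨a, b⟩ h
    have hab : a < b := by simpa using h
    by_cases h1 : σ a < σ b
    · by_cases h2 : τ a < τ b
      · simp [h1, h2, h2.not_gt]
      · have : τ b < τ a := lt_of_le_of_ne (not_lt.1 h2) (by simpa using hab.ne')
        simp [h1, h2, this]
    · have h1' : σ b < σ a := lt_of_le_of_ne (not_lt.1 h1) (by simpa using hab.ne')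
      by_cases h2 : τ a < τ b
      · simp [h1, h2, h1']
      · simp [h1, h2, h1']

variable {H : Type*} [NormedAddCommGroup H] [InnerProductSpace ℝ H]

theorem tensorForm_average (q : ℝ) {n : ℕ} (v w : Fin n → H) :
    ∑ σ : Equiv.Perm (Fin n), ∑ τ : Equiv.Perm (Fin n),
      q ^ invCount (τ * σ⁻¹) * ∏ i, ⟪v (σ i), w (τ i)⟫_ℝ = n.factorial * tensorForm q v w := by
  have key : ∀ σ : Equiv.Perm (Fin n), ∑ τ : Equiv.Perm (Fin n),
      q ^ invCount (τ * σ⁻¹) * ∏ i, ⟪v (σ i), w (τ i)⟫_ℝ = tensorForm q v w := by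
    intro σ
    rw [tensorForm, ← Equiv.sum_comp (Equiv.mulRight σ)]
    refine Finset.sum_congr rfl fun τ _ => ?_
    rw [← Equiv.prod_comp σ (fun i => ⟪v i, w (τ i)⟫_ℝ)]
    simp
  simp [key, Fintype.card_perm]

theorem tensorForm_psd (q : ℝ) (h₁ : -1 ≤ q) (h₂ : q ≤ 1) (n : ℕ) :
    Matrix.PosSemidef (fun v w => tensorForm q v w : Matrix (Fin n → H) (Fin n → H) ℝ) := by
  let A : Fin n × Fin n →
      Matrix (Equiv.Perm (Fin n) × (Fin n → H)) (Equiv.Perm (Fin n) × (Fin n → H)) ℝ :=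
    fun p x y => if (x.1 p.1 < x.1 p.2 ↔ y.1 p.1 < y.1 p.2) then (1 : ℝ) else q
  let B : Fin n →
      Matrix (Equiv.Perm (Fin n) × (Fin n → H)) (Equiv.Perm (Fin n) × (Fin n → H)) ℝ :=
    fun i x y => ⟪x.2 (x.1 i), y.2 (y.1 i)⟫_ℝ
  have hA := psd_prod (Finset.univ.filter (fun p : Fin n × Fin n => p.1 < p.2)) A
    fun p => psd_two q h₁ h₂ (fun x : Equiv.Perm (Fin n) × (Fin n → H) => x.1 p.1 < x.1 p.2)
  have hB := psd_prod Finset.univ B fun i => psd_gram (fun x : Equiv.Perm (Fin n) × (Fin n → H) => x.2 (x.1 i))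
  have C := (psd_average (hA.hadamard hB)).smul (a := ((n.factorial : ℝ)⁻¹)) (by positivity)
  refine (congrArg Matrix.PosSemidef ?_).mpr C
  ext v w
  have hn : (n.factorial : ℝ) ≠ 0 := by positivity
  rw [← inv_mul_cancel_left₀ hn (tensorForm q v w), ← tensorForm_average q v w]
  simp only [pow_invCount_mul_inv]
  rfl

theorem wordForm_psd (q : ℝ) (h₁ : -1 ≤ q) (h₂ : q ≤ 1) :
    Matrix.PosSemidef (fun v w => wordForm q v w : Matrix (FockWord H) (FockWord H) ℝ) := by
  refine ⟨?_, fun x => ?_⟩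
  · ext ⟨n, v⟩ ⟨m, w⟩
    change wordForm q ⟨m, w⟩ ⟨n, v⟩ = wordForm q ⟨n, v⟩ ⟨m, w⟩
    by_cases h : n = m
    · subst h
      have e : tensorForm q w v = tensorForm q v w :=
        (tensorForm_psd (H := H) q h₁ h₂ n).1.apply v w
      simpa [wordForm] using e
    · simp [wordForm, h, Ne.symm h]
  · rw [Finsupp.sigma_sum]
    refine Finset.sum_nonneg fun n _ => ?_
    refine ((tensorForm_psd (H := H) q h₁ h₂ n).2 (x.split n)).trans_eq ?_
    refine Finsupp.sum_congr fun v _ => ?_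
    rw [Finsupp.sigma_sum, Finset.sum_eq_single n]
    · refine Finsupp.sum_congr fun w _ => ?_
      simp [wordForm]
    · intro m _ hm
      refine Finset.sum_eq_zero fun w _ => ?_
      simp [wordForm, Ne.symm hm]
    · intro hn
      rw [Finsupp.mem_splitSupport_iff_nonzero, not_not] at hn
      simp [hn]

end Positivity

section PreFock

variable (q : Set.Ioo (-1 : ℝ) 1) (H : Type*) [NormedAddCommGroup H] [InnerProductSpace ℝ H]

/-- Formal complex linear combinations of words, with the (semi-definite) `q`-inner product.
The elementary tensors of real vectors span `ℋ^{⊗ n}` over `ℂ`, where `ℋ` is the complexification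
of `H`; the multilinear relations between them hold up to vectors of norm `0`, which the completion
below identifies with `0`. -/
def PreFock (_q : Set.Ioo (-1 : ℝ) 1) (H : Type*) [NormedAddCommGroup H]
    [InnerProductSpace ℝ H] : Type _ := FockWord H →₀ ℂ

instance : AddCommGroup (PreFock q H) := inferInstanceAs (AddCommGroup (FockWord H →₀ ℂ))

instance : Module ℂ (PreFock q H) := inferInstanceAs (Module ℂ (FockWord H →₀ ℂ))

variable {H}

/-- The sesquilinear form with `⟨a, b⟩ = wordForm q a b` on words. -/
def preInner (x y : FockWord H →₀ ℂ) : ℂ :=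
  x.sum fun a s => y.sum fun b t => conj s * t * (wordForm (q : ℝ) a b : ℂ)

theorem wordForm_comm (a b : FockWord H) : wordForm (q : ℝ) a b = wordForm (q : ℝ) b a :=
  ((wordForm_psd (H := H) (q : ℝ) q.2.1.le q.2.2.le).1.apply a b).symm

theorem preInner_self_nonneg (x : FockWord H →₀ ℂ) : 0 ≤ (preInner q x x).re := by
  have h := psd_finset (wordForm_psd (H := H) (q : ℝ) q.2.1.le q.2.2.le) x.support
  have h1 := h fun a => (x a).re
  have h2 := h fun a => (x a).im
  refine (add_nonneg h1 h2).trans_eq ?_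
  simp only [preInner, Finsupp.sum, Complex.re_sum, ← Finset.sum_add_distrib]
  refine Finset.sum_congr rfl fun a _ => Finset.sum_congr rfl fun b _ => ?_
  simp; ring

theorem preInner_conj (x y : FockWord H →₀ ℂ) : conj (preInner q y x) = preInner q x y := by
  simp only [preInner, Finsupp.sum, map_sum]
  rw [Finset.sum_comm]
  refine Finset.sum_congr rfl fun a _ => Finset.sum_congr rfl fun b _ => ?_
  rw [wordForm_comm q b a]
  simp only [map_mul, Complex.conj_conj, Complex.conj_ofReal]
  ring

theorem preInner_add (x y z : FockWord H →₀ ℂ) :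
    preInner q (x + y) z = preInner q x z + preInner q y z := by
  refine Finsupp.sum_add_index' (by simp) fun a s t => ?_
  rw [← Finsupp.sum_add]
  refine Finsupp.sum_congr fun b _ => ?_
  rw [map_add]; ring

theorem preInner_smul (x y : FockWord H →₀ ℂ) (r : ℂ) :
    preInner q (r • x) y = conj r * preInner q x y := by
  refine (Finsupp.sum_smul_index (by simp)).trans ?_
  rw [preInner, Finsupp.mul_sum]
  refine Finsupp.sum_congr fun a _ => ?_
  rw [Finsupp.mul_sum]
  refine Finsupp.sum_congr fun b _ => ?_
  rw [map_mul]; ring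

variable (H)

instance preCore : PreInnerProductSpace.Core ℂ (PreFock q H) where
  inner := preInner q
  conj_inner_symm := preInner_conj q
  re_inner_nonneg := preInner_self_nonneg q
  add_left := preInner_add q
  smul_left := preInner_smul q

instance : SeminormedAddCommGroup (PreFock q H) :=
  InnerProductSpace.Core.toSeminormedAddCommGroup (𝕜 := ℂ)

instance : InnerProductSpace ℂ (PreFock q H) := InnerProductSpace.ofCore (preCore q H)

/-- The `q`-Fock space `⨁ₙ ℋ_q^{⊗ n}` over the real Hilbert space `H`: the Hausdorff completion of
the span of the elementary tensors in the `q`-inner product. -/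
abbrev Fock : Type _ := UniformSpace.Completion (PreFock q H)

variable {H}

/-- The word `a` as an element of `PreFock q H`. -/
def preWord (a : FockWord H) : PreFock q H := Finsupp.single a (1 : ℂ)

/-- The elementary tensor `v₁ ⊗ ⋯ ⊗ vₙ` in the `q`-Fock space. -/
def tensor {n : ℕ} (v : Fin n → H) : Fock q H := (preWord q ⟨n, v⟩ : PreFock q H)

variable (H) in
/-- The vacuum vector `Ω`. -/
def vacuum : Fock q H := tensor q (Fin.elim0 : Fin 0 → H)

theorem inner_preWord (a b : FockWord H) :
    ⟪preWord q a, preWord q b⟫_ℂ = (wordForm (q : ℝ) a b : ℂ) := by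
  change preInner q _ _ = _
  simp [preInner, preWord]

theorem inner_tensor {n : ℕ} (v w : Fin n → H) :
    ⟪tensor q v, tensor q w⟫_ℂ = (tensorForm (q : ℝ) v w : ℂ) := by
  rw [tensor, tensor, UniformSpace.Completion.inner_coe, inner_preWord, wordForm_same]

theorem preFock_induction {p : PreFock q H → Prop} (h0 : p 0)
    (hadd : ∀ x y, p x → p y → p (x + y)) (hw : ∀ (c : ℂ) a, p (c • preWord q a)) (x) : p x := by
  refine Finsupp.induction_linear (motive := p) x h0 (fun x y => hadd x y) fun a c => ?_
  have e : (c • (Finsupp.single a (1 : ℂ) : FockWord H →₀ ℂ) : FockWord H →₀ ℂ)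
    = Finsupp.single a c := by simp
  exact e ▸ hw c a

/-- The linear map on `PreFock q H` with given values on words. -/
def preLift {E : Type*} [AddCommGroup E] [Module ℂ E] (f : FockWord H → E) :
    PreFock q H →ₗ[ℂ] E :=
  Finsupp.linearCombination ℂ f

@[simp] theorem preLift_preWord {E : Type*} [AddCommGroup E] [Module ℂ E] (f : FockWord H → E)
    (a : FockWord H) : preLift q f (preWord q a) = f a :=
  (Finsupp.linearCombination_single ℂ (1 : ℂ) a).trans (one_smul ℂ (f a))

theorem inner_preLift_eq {f g : FockWord H → PreFock q H}
    (h : ∀ a b, ⟪f a, preWord q b⟫_ℂ = ⟪preWord q a, g b⟫_ℂ) (x y : PreFock q H) :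
    ⟪preLift q f x, y⟫_ℂ = ⟪x, preLift q g y⟫_ℂ := by
  induction x using preFock_induction q with
  | h0 => simp
  | hadd x x' hx hx' => simp [inner_add_left, hx, hx']
  | hw c a =>
    induction y using preFock_induction q with
    | h0 => simp
    | hadd x x' hx hx' => simp only [map_add, inner_add_right, hx, hx']
    | hw d b => simp [inner_smul_left, inner_smul_right, h]

end PreFock

section Operators

/-- The permutation `σ` with `σ 0 = i` and `σ (j + 1) = i.succAbove (ρ j)`. -/
def permCons {n : ℕ} (i : Fin (n + 1)) (ρ : Equiv.Perm (Fin n)) : Equiv.Perm (Fin (n + 1)) :=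
  ((finSuccEquiv' 0).trans (Equiv.optionCongr ρ)).trans (finSuccEquiv' i).symm

@[simp] theorem permCons_zero {n : ℕ} (i : Fin (n + 1)) (ρ : Equiv.Perm (Fin n)) :
    permCons i ρ 0 = i := by
  simp [permCons]

@[simp] theorem permCons_succ {n : ℕ} (i : Fin (n + 1)) (ρ : Equiv.Perm (Fin n)) (j : Fin n) :
    permCons i ρ j.succ = i.succAbove (ρ j) := by
  have : finSuccEquiv' 0 j.succ = some j := by
    rw [← Fin.succAbove_zero, finSuccEquiv'_succAbove]
  simp [permCons, this]

theorem permCons_bijective (n : ℕ) :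
    Function.Bijective fun p : Fin (n + 1) × Equiv.Perm (Fin n) => permCons p.1 p.2 := by
  rw [Fintype.bijective_iff_injective_and_card]
  refine ⟨?_, by simp [Fintype.card_perm, Nat.factorial_succ]⟩
  rintro ⟨i, ρ⟩ ⟨j, τ⟩ h
  have h0 : i = j := by simpa using congrArg (fun σ => σ 0) h
  subst h0
  have : ρ = τ := by
    ext k
    have := congrArg (fun σ => σ k.succ) h
    simpa using congrArg Fin.val (by simpa using this : ρ k = τ k)
  rw [this]

theorem invCount_eq {n : ℕ} (σ : Equiv.Perm (Fin n)) :
    invCount σ = ∑ a, ∑ b, if a < b ∧ σ b < σ a then 1 else 0 := by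
  rw [invCount, Finset.card_filter, Fintype.sum_prod_type]

theorem invCount_permCons {n : ℕ} (i : Fin (n + 1)) (ρ : Equiv.Perm (Fin n)) :
    invCount (permCons i ρ) = i + invCount ρ := by
  rw [invCount_eq, invCount_eq, Fin.sum_univ_succ]
  congr 1
  · rw [Fin.sum_univ_succ]
    simp only [permCons_zero, permCons_succ, lt_self_iff_false, false_and, if_false, zero_add,
      Fin.succ_pos, true_and, Fin.succAbove_lt_iff_castSucc_lt]
    rw [Equiv.sum_comp ρ (fun k => if k.castSucc < i then 1 else 0), ← Finset.card_filter]
    have : (Finset.univ.filter fun k : Fin n => k.castSucc < i).card = (Finset.range i).card := by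
      refine Finset.card_bij (fun k _ => (k : ℕ)) ?_ ?_ ?_
      · intro k hk; simpa [Fin.lt_def] using hk
      · intro k _ l _ h; exact Fin.ext h
      · intro m hm
        have hm' : m < i := by simpa using hm
        exact ⟨⟨m, by omega⟩, by simpa [Fin.lt_def] using hm', rfl⟩
    simpa using this
  · refine Finset.sum_congr rfl fun a _ => ?_
    rw [Fin.sum_univ_succ]
    simp [Fin.succAbove_lt_succAbove_iff]

/-- The reversal `(v₁, …, vₙ) ↦ (vₙ, …, v₁)` of words. -/
def revWord {H : Type*} (a : FockWord H) : FockWord H := ⟨a.1, a.2 ∘ Fin.rev⟩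

theorem revWord_revWord {H : Type*} (a : FockWord H) : revWord (revWord a) = a := by
  obtain ⟨n, v⟩ := a
  simp [revWord, Function.comp_def]

variable (q : Set.Ioo (-1 : ℝ) 1) {H : Type*} [NormedAddCommGroup H] [InnerProductSpace ℝ H]

theorem tensorForm_cons (q : ℝ) {n : ℕ} (φ : H) (v : Fin n → H) (w : Fin (n + 1) → H) :
    tensorForm q (Fin.cons φ v : Fin (n + 1) → H) w
      = ∑ i : Fin (n + 1), q ^ (i : ℕ) * ⟪φ, w i⟫_ℝ * tensorForm q v (i.removeNth w) := by
  rw [tensorForm, ← (permCons_bijective n).sum_comp, Fintype.sum_prod_type]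
  refine Finset.sum_congr rfl fun i _ => ?_
  rw [tensorForm, Finset.mul_sum]
  refine Finset.sum_congr rfl fun ρ _ => ?_
  rw [invCount_permCons, Fin.prod_univ_succ]
  simp [Fin.removeNth, pow_add]
  ring

theorem tensorForm_rev (q : ℝ) {n : ℕ} (v w : Fin n → H) :
    tensorForm q (v ∘ Fin.rev) (w ∘ Fin.rev) = tensorForm q v w := by
  rw [tensorForm, tensorForm, ← Equiv.sum_comp (Equiv.permCongr Fin.revPerm)]
  refine Finset.sum_congr rfl fun σ _ => ?_
  congr 1
  · congr 1
    refine Finset.card_bij' (fun p _ => (p.2.rev, p.1.rev)) (fun p _ => (p.2.rev, p.1.rev))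
      ?_ ?_ ?_ ?_ <;> simp
  · rw [← Equiv.prod_comp Fin.revPerm]
    simp

/-- Left creation on words: `(v₁, …, vₙ) ↦ (φ, v₁, …, vₙ)`. -/
def consWord (φ : H) (a : FockWord H) : FockWord H := ⟨a.1 + 1, Fin.cons φ a.2⟩

/-- `l_φ (v₁ ⊗ ⋯ ⊗ vₙ) = ∑ i, q ^ (i - 1) (φ, vᵢ) v₁ ⊗ ⋯ v̂ᵢ ⋯ ⊗ vₙ`, where `l_φ Ω = 0`. -/
def annihilateWord (φ : H) : FockWord H → PreFock q H
  | ⟨0, _⟩ => 0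
  | ⟨n + 1, w⟩ =>
    ∑ i : Fin (n + 1), (((q : ℝ) ^ (i : ℕ) * ⟪φ, w i⟫_ℝ : ℝ) : ℂ) • preWord q ⟨n, i.removeNth w⟩

/-- Left creation on `PreFock q H`. -/
def preCreation (φ : H) : PreFock q H →ₗ[ℂ] PreFock q H :=
  preLift q fun a => preWord q (consWord φ a)

/-- Left annihilation on `PreFock q H`. -/
def preAnnihilation (φ : H) : PreFock q H →ₗ[ℂ] PreFock q H := preLift q (annihilateWord q φ)

theorem inner_preCreation (φ : H) (x y : PreFock q H) :
    ⟪preCreation q φ x, y⟫_ℂ = ⟪x, preAnnihilation q φ y⟫_ℂ := by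
  refine inner_preLift_eq q (fun a b => ?_) x y
  obtain ⟨n, v⟩ := a
  obtain ⟨m, w⟩ := b
  rw [inner_preWord]
  cases m with
  | zero => simp [annihilateWord, wordForm, consWord]
  | succ m =>
    simp only [annihilateWord, inner_sum, inner_smul_right, inner_preWord]
    by_cases h : n = m
    · subst h
      rw [consWord, wordForm_same, tensorForm_cons]
      simp [wordForm_same]
    · simp [wordForm, consWord, h]

theorem preAnnihilation_preCreation (φ : H) (x : PreFock q H) :
    preAnnihilation q φ (preCreation q φ x)
      = ((‖φ‖ ^ 2 : ℝ) : ℂ) • x + ((q : ℝ) : ℂ) • preCreation q φ (preAnnihilation q φ x) := by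
  induction x using preFock_induction q with
  | h0 => simp
  | hadd x y hx hy => simp only [map_add, hx, hy, smul_add]; abel
  | hw c a =>
    simp only [map_smul]
    rw [smul_comm _ c, smul_comm _ c, ← smul_add]
    congr 1
    obtain ⟨n, w⟩ := a
    simp only [preCreation, preAnnihilation, preLift_preWord, consWord, annihilateWord]
    rw [Fin.sum_univ_succ]
    congr 1
    · have e : (Fin.removeNth (α := fun _ => H) 0 (Fin.cons φ w)) = w := by ext; simp [Fin.removeNth]
      rw [e]
      simp
    · cases n with
      | zero => simp
      | succ n =>
        simp only [map_sum, map_smul, preLift_preWord, Finset.smul_sum]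
        refine Finset.sum_congr rfl fun i _ => ?_
        have e : (Fin.removeNth (α := fun _ => H) i.succ (Fin.cons φ w))
            = Fin.cons φ (i.removeNth w) := by
          ext j
          refine Fin.cases ?_ (fun j => ?_) j <;> simp [Fin.removeNth]
        rw [e, smul_smul]
        simp [pow_succ]
        ring_nf

/-- Combinations of words of length at most `N`. -/
def degLE (N : ℕ) : Submodule ℂ (PreFock q H) :=
  Submodule.span ℂ ((preWord q) '' {a : FockWord H | a.1 ≤ N})

theorem mem_degLE (x : PreFock q H) : ∃ N, x ∈ degLE q (H := H) N := by
  induction x using preFock_induction q with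
  | h0 => exact ⟨0, zero_mem _⟩
  | hadd x y hx hy =>
    obtain ⟨N, hN⟩ := hx
    obtain ⟨M, hM⟩ := hy
    have mono : ∀ {a b : ℕ}, a ≤ b → degLE q (H := H) a ≤ degLE q b := fun h =>
      Submodule.span_mono (Set.image_mono fun w (hw : w.1 ≤ _) => hw.trans h)
    exact ⟨max N M, add_mem (mono (le_max_left _ _) hN) (mono (le_max_right _ _) hM)⟩
  | hw c a => exact ⟨a.1, Submodule.smul_mem _ _ (Submodule.subset_span ⟨a, (le_rfl : a.1 ≤ a.1), rfl⟩)⟩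

theorem preAnnihilation_zero (φ : H) {x : PreFock q H} (hx : x ∈ degLE q (H := H) 0) :
    preAnnihilation q φ x = 0 := by
  refine Submodule.span_induction (p := fun x _ => preAnnihilation q φ x = 0) ?_ (by simp)
    (fun x y _ _ hx hy => by simp [hx, hy]) (fun c x _ hx => by simp [hx]) hx
  rintro _ ⟨⟨n, w⟩, hn, rfl⟩
  obtain rfl : n = 0 := by simpa using hn
  simp [preAnnihilation, annihilateWord]

theorem preAnnihilation_succ (φ : H) {N : ℕ} {x : PreFock q H} (hx : x ∈ degLE q (H := H) (N + 1)) :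
    preAnnihilation q φ x ∈ degLE q (H := H) N := by
  refine Submodule.span_induction (p := fun x _ => preAnnihilation q φ x ∈ degLE q (H := H) N) ?_
    (by simp) (fun x y _ _ hx hy => by simpa using add_mem hx hy)
    (fun c x _ hx => by simpa using Submodule.smul_mem _ _ hx) hx
  rintro _ ⟨⟨n, w⟩, hn, rfl⟩
  rw [preAnnihilation, preLift_preWord]
  cases n with
  | zero => simp [annihilateWord]
  | succ n =>
    refine Submodule.sum_mem _ fun i _ => Submodule.smul_mem _ _ (Submodule.subset_span ⟨_, ?_, rfl⟩)
    simpa using hn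

theorem norm_preCreation_sq (φ : H) (x : PreFock q H) :
    ‖preCreation q φ x‖ ^ 2 = ‖φ‖ ^ 2 * ‖x‖ ^ 2 + q * ‖preAnnihilation q φ x‖ ^ 2 := by
  have h1 : ⟪x, preCreation q φ (preAnnihilation q φ x)⟫_ℂ
      = ⟪preAnnihilation q φ x, preAnnihilation q φ x⟫_ℂ := by
    rw [← inner_conj_symm, inner_preCreation, inner_conj_symm]
  have h := inner_preCreation q φ x (preCreation q φ x)
  rw [preAnnihilation_preCreation, inner_add_right, inner_smul_right, inner_smul_right, h1,
    inner_self_eq_norm_sq_to_K, inner_self_eq_norm_sq_to_K, inner_self_eq_norm_sq_to_K] at h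
  refine Complex.ofReal_injective ?_
  push_cast at h ⊢
  exact h

theorem norm_preCreation_deg (φ : H) (N : ℕ) : ∀ x ∈ degLE q (H := H) N,
    ‖preCreation q φ x‖ ^ 2 ≤ ‖φ‖ ^ 2 / (1 - |(q : ℝ)|) * ‖x‖ ^ 2 := by
  have hq : |(q : ℝ)| < 1 := abs_lt.2 q.2
  have hC : ‖φ‖ ^ 2 ≤ ‖φ‖ ^ 2 / (1 - |(q : ℝ)|) :=
    le_div_self (by positivity) (by linarith) (by linarith [abs_nonneg (q : ℝ)])
  set C := ‖φ‖ ^ 2 / (1 - |(q : ℝ)|) with hCdef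
  have hC0 : 0 ≤ C := le_trans (by positivity) hC
  have hCq : ‖φ‖ ^ 2 + |(q : ℝ)| * C = C := by
    have : (1 - |(q : ℝ)|) ≠ 0 := by linarith
    rw [hCdef]; field_simp; ring
  induction N with
  | zero =>
    intro x hx
    rw [norm_preCreation_sq, preAnnihilation_zero q φ hx]
    simpa using mul_le_mul_of_nonneg_right hC (sq_nonneg ‖x‖)
  | succ N ih =>
    intro x hx
    set y := preAnnihilation q φ x with hy
    have hl : ‖y‖ ^ 2 ≤ C * ‖x‖ ^ 2 := by
      have h1 := ih y (preAnnihilation_succ q φ hx)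
      have h2 : ‖y‖ ^ 2 ≤ ‖preCreation q φ y‖ * ‖x‖ := by
        have h3 := inner_preCreation q φ y x
        rw [← hy, inner_self_eq_norm_sq_to_K] at h3
        have h4 := norm_inner_le_norm (𝕜 := ℂ) (preCreation q φ y) x
        rw [h3] at h4
        simpa using h4
      have h5 : (‖y‖ ^ 2) ^ 2 ≤ (C * ‖x‖ ^ 2) * ‖y‖ ^ 2 := by
        calc (‖y‖ ^ 2) ^ 2 ≤ (‖preCreation q φ y‖ * ‖x‖) ^ 2 := by gcongr
          _ = ‖preCreation q φ y‖ ^ 2 * ‖x‖ ^ 2 := by ring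
          _ ≤ (C * ‖y‖ ^ 2) * ‖x‖ ^ 2 := by gcongr
          _ = _ := by ring
      rcases (sq_nonneg ‖y‖).eq_or_lt with h0 | h0
      · rw [← h0]; positivity
      · nlinarith
    rw [norm_preCreation_sq, ← hy]
    calc ‖φ‖ ^ 2 * ‖x‖ ^ 2 + q * ‖y‖ ^ 2
        ≤ ‖φ‖ ^ 2 * ‖x‖ ^ 2 + |(q : ℝ)| * (C * ‖x‖ ^ 2) := by
          gcongr
          exact le_abs_self _
      _ = (‖φ‖ ^ 2 + |(q : ℝ)| * C) * ‖x‖ ^ 2 := by ring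
      _ = C * ‖x‖ ^ 2 := by rw [hCq]

theorem norm_preCreation_le (φ : H) (x : PreFock q H) :
    ‖preCreation q φ x‖ ≤ √(‖φ‖ ^ 2 / (1 - |(q : ℝ)|)) * ‖x‖ := by
  obtain ⟨N, hN⟩ := mem_degLE q x
  have h := norm_preCreation_deg q φ N x hN
  have hq : 0 < 1 - |(q : ℝ)| := by linarith [abs_lt.2 q.2]
  refine (pow_le_pow_iff_left₀ (norm_nonneg _) (by positivity) two_ne_zero).1 ?_
  rwa [mul_pow, Real.sq_sqrt (by positivity)]

/-- The left creation operator `l*_φ` on the `q`-Fock space,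
`l*_φ (v₁ ⊗ ⋯ ⊗ vₙ) = φ ⊗ v₁ ⊗ ⋯ ⊗ vₙ`. -/
def creation (φ : H) : Fock q H →L[ℂ] Fock q H :=
  ((preCreation q φ).mkContinuous _ (norm_preCreation_le q φ)).completion

/-- The left annihilation operator `l_φ`, the adjoint of `l*_φ`. -/
def annihilation (φ : H) : Fock q H →L[ℂ] Fock q H := (creation q φ).adjoint

theorem creation_tensor (φ : H) {n : ℕ} (v : Fin n → H) :
    creation q φ (tensor q v) = tensor q (Fin.cons φ v : Fin (n + 1) → H) := by
  simp [creation, tensor, preCreation, consWord]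

/-- Reversal of words on `PreFock q H`. -/
def preReversal : PreFock q H →ₗ[ℂ] PreFock q H := preLift q fun a => preWord q (revWord a)

theorem preReversal_preReversal (x : PreFock q H) : preReversal q (preReversal q x) = x := by
  induction x using preFock_induction q with
  | h0 => simp
  | hadd x y hx hy => simp [hx, hy]
  | hw c a => simp [preReversal, revWord_revWord]

theorem wordForm_rev (a b : FockWord H) :
    wordForm (q : ℝ) (revWord a) (revWord b) = wordForm (q : ℝ) a b := by
  obtain ⟨n, v⟩ := a
  obtain ⟨m, w⟩ := b
  by_cases h : n = m
  · subst h
    rw [revWord, revWord, wordForm_same, wordForm_same, tensorForm_rev]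
  · simp [wordForm, revWord, h]

theorem norm_preReversal (x : PreFock q H) : ‖preReversal q x‖ = ‖x‖ := by
  have h := inner_preLift_eq q (f := fun a => preWord q (revWord a))
    (g := fun a => preWord q (revWord a)) (fun a b => by
      rw [inner_preWord, inner_preWord, ← wordForm_rev, revWord_revWord]) x (preReversal q x)
  change ⟪preReversal q x, preReversal q x⟫_ℂ = ⟪x, preReversal q (preReversal q x)⟫_ℂ at h
  rw [preReversal_preReversal, inner_self_eq_norm_sq_to_K, inner_self_eq_norm_sq_to_K] at h
  have h' : ‖preReversal q x‖ ^ 2 = ‖x‖ ^ 2 := by exact_mod_cast h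
  exact (sq_eq_sq₀ (norm_nonneg _) (norm_nonneg _)).1 h'

variable (H) in
/-- The unitary `v₁ ⊗ ⋯ ⊗ vₙ ↦ vₙ ⊗ ⋯ ⊗ v₁` of the `q`-Fock space. -/
def reversal : Fock q H →L[ℂ] Fock q H :=
  ((preReversal q).mkContinuous 1 fun x => by rw [norm_preReversal, one_mul]).completion

/-- The right creation operator `r*_φ`, `r*_φ (v₁ ⊗ ⋯ ⊗ vₙ) = v₁ ⊗ ⋯ ⊗ vₙ ⊗ φ`, obtained from
`l*_φ` by reversing tensors before and after. -/
def rightCreation (φ : H) : Fock q H →L[ℂ] Fock q H :=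
  reversal q H ∘L creation q φ ∘L reversal q H

/-- The right annihilation operator `r_φ`, the adjoint of `r*_φ`. -/
def rightAnnihilation (φ : H) : Fock q H →L[ℂ] Fock q H := (rightCreation q φ).adjoint

theorem reversal_tensor {n : ℕ} (v : Fin n → H) :
    reversal q H (tensor q v) = tensor q (v ∘ Fin.rev) := by
  simp [reversal, tensor, preReversal, revWord]

theorem rightCreation_tensor (φ : H) {n : ℕ} (v : Fin n → H) :
    rightCreation q φ (tensor q v) = tensor q (Fin.snoc v φ : Fin (n + 1) → H) := by
  simp only [rightCreation, ContinuousLinearMap.comp_apply, reversal_tensor, creation_tensor]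
  congr 1
  ext i
  refine Fin.lastCases ?_ (fun i => ?_) i
  · simp
  · simp [Fin.rev_castSucc]

theorem annihilation_tensor (φ : H) {n : ℕ} (w : Fin (n + 1) → H) :
    annihilation q φ (tensor q w)
      = ∑ i : Fin (n + 1),
        (((q : ℝ) ^ (i : ℕ) * ⟪φ, w i⟫_ℝ : ℝ) : ℂ) • tensor q (i.removeNth w) := by
  have key : annihilation q φ (tensor q w)
      = ((preAnnihilation q φ (preWord q ⟨n + 1, w⟩) : PreFock q H) : Fock q H) := by
    refine ext_inner_left ℂ fun x => ?_
    rw [annihilation, ContinuousLinearMap.adjoint_inner_right]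
    induction x using UniformSpace.Completion.induction_on with
    | hp => exact isClosed_eq (by fun_prop) (by fun_prop)
    | ih x =>
      simp only [creation, tensor, ContinuousLinearMap.completion_apply_coe,
        LinearMap.mkContinuous_apply, UniformSpace.Completion.inner_coe, inner_preCreation]
  rw [key]
  simp only [preAnnihilation, preLift_preWord, annihilateWord, tensor]
  change UniformSpace.Completion.toComplL (𝕜 := ℂ) _ = _
  simp [map_sum]

end Operators

section VonNeumann

variable {E : Type*} [NormedAddCommGroup E] [InnerProductSpace ℂ E] [CompleteSpace E]

/-- The von Neumann algebra generated by a set `S` of bounded operators: the double commutant of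
`S ∪ S*`. -/
def generatedVN (S : Set (E →L[ℂ] E)) : VonNeumannAlgebra E where
  toStarSubalgebra :=
    StarSubalgebra.centralizer ℂ (StarSubalgebra.centralizer ℂ S : Set (E →L[ℂ] E))
  centralizer_centralizer' := by
    change Set.centralizer (Set.centralizer
      (StarSubalgebra.centralizer ℂ (StarSubalgebra.centralizer ℂ S : Set (E →L[ℂ] E)) :
        Set (E →L[ℂ] E))) =
      (StarSubalgebra.centralizer ℂ (StarSubalgebra.centralizer ℂ S : Set (E →L[ℂ] E)) :
        Set (E →L[ℂ] E))
    rw [StarSubalgebra.coe_centralizer_centralizer, Set.centralizer_centralizer_centralizer]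

/-- A von Neumann algebra is a factor if its centre consists of the scalars. -/
def IsFactor (M : VonNeumannAlgebra E) : Prop :=
  ∀ x ∈ M, x ∈ M.commutant → ∃ c : ℂ, x = c • (1 : E →L[ℂ] E)

/-- `τ` is a faithful normal tracial state on `M`. Normality: `τ` is a countable sum of vector
functionals `x ↦ ⟨ξₖ, x ξₖ⟩` with `∑ ‖ξₖ‖² < ∞`. -/
structure IsFaithfulNormalTracialState (M : VonNeumannAlgebra E)
    (τ : M.toStarSubalgebra →ₗ[ℂ] ℂ) : Prop where
  map_one : τ 1 = 1
  nonneg : ∀ x, 0 ≤ (τ (star x * x)).re ∧ (τ (star x * x)).im = 0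
  normal : ∃ ξ : ℕ → E, Summable (fun k => ‖ξ k‖ ^ 2) ∧
    ∀ x : M.toStarSubalgebra, HasSum (fun k => ⟪ξ k, (x : E →L[ℂ] E) (ξ k)⟫_ℂ) (τ x)
  tracial : ∀ x y, τ (x * y) = τ (y * x)
  faithful : ∀ x, τ (star x * x) = 0 → x = 0

/-- A type `II₁` factor: an infinite-dimensional factor that has a faithful normal tracial
state. -/
def IsTypeIIOneFactor (M : VonNeumannAlgebra E) : Prop :=
  IsFactor M ∧ ¬ FiniteDimensional ℂ M.toStarSubalgebra ∧
    ∃ τ : M.toStarSubalgebra →ₗ[ℂ] ℂ, IsFaithfulNormalTracialState M τ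

/-- Property `Γ` of Murray and von Neumann for a `II₁` factor `M` with trace `τ`: for all
`x₁, …, xₘ ∈ M` and `ε > 0` there is a unitary `u ∈ M` with `τ u = 0` and
`‖xᵢ u - u xᵢ‖₂ < ε` for all `i`, where `‖y‖₂ = τ (y* y) ^ (1/2)`. -/
def HasPropertyGamma (M : VonNeumannAlgebra E) (τ : M.toStarSubalgebra →ₗ[ℂ] ℂ) : Prop :=
  ∀ (s : Finset M.toStarSubalgebra) (ε : ℝ), 0 < ε →
    ∃ u ∈ unitary M.toStarSubalgebra, τ u = 0 ∧
      ∀ x ∈ s, √(τ (star (x * u - u * x) * (x * u - u * x))).re < ε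

/-- The vector functional `x ↦ ⟨ξ, x ξ⟩` on `M`. -/
def vectorFunctional (M : VonNeumannAlgebra E) (ξ : E) : M.toStarSubalgebra →ₗ[ℂ] ℂ where
  toFun x := ⟪ξ, (x : E →L[ℂ] E) ξ⟫_ℂ
  map_add' x y := by simp
  map_smul' c x := by simp

end VonNeumann

section Main

variable (q : Set.Ioo (-1 : ℝ) 1) {H : Type*} [NormedAddCommGroup H] [InnerProductSpace ℝ H]

/-- The left `q`-Gaussian operator `L_φ = l_φ + l*_φ`. -/
def leftGaussian (φ : H) : Fock q H →L[ℂ] Fock q H := annihilation q φ + creation q φ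

/-- The right `q`-Gaussian operator `R_φ = r_φ + r*_φ`. -/
def rightGaussian (φ : H) : Fock q H →L[ℂ] Fock q H := rightAnnihilation q φ + rightCreation q φ

variable (H) in
/-- The `q`-Gaussian von Neumann algebra `Γ_q`, generated by the operators `L_φ`, `φ ∈ H`. -/
def gaussianVN : VonNeumannAlgebra (Fock q H) :=
  generatedVN (Set.range fun φ : H => leftGaussian q φ)

variable (H) in
/-- The vacuum state `x ↦ ⟨Ω, x Ω⟩` on `Γ_q`. -/
def vacuumState : (gaussianVN q H).toStarSubalgebra →ₗ[ℂ] ℂ :=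
  vectorFunctional (gaussianVN q H) (vacuum q H)

/-- The positive operator `|M| = (∑ᵢ (L_{eᵢ} - R_{eᵢ})²)^{1/2}`. -/
def gapOperator {d : ℕ} (e : Fin d → H) : Fock q H →L[ℂ] Fock q H :=
  CFC.sqrt (∑ i, (leftGaussian q (e i) - rightGaussian q (e i)) ^ 2)

/-- `d₀` is a gap constant for `q`: for every real Hilbert space `H` and every orthonormal system
`e₁, …, e_d` in `H` (that is, an orthonormal basis of a `d`-dimensional subspace of `H`) with
`d ≥ d₀` there is `ε > 0` such that `|M| ≥ ε` on the orthogonal complement of the vacuum. -/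
def IsGapConstant.{u} (q : Set.Ioo (-1 : ℝ) 1) (d₀ : ℕ) : Prop :=
  ∀ (H : Type u) [NormedAddCommGroup H] [InnerProductSpace ℝ H] [CompleteSpace H]
    (d : ℕ) (e : Fin d → H), Orthonormal ℝ e → d₀ ≤ d →
    ∃ ε : ℝ, 0 < ε ∧ ∀ x : Fock q H, ⟪vacuum q H, x⟫_ℂ = 0 →
      ε * ‖x‖ ^ 2 ≤ (⟪x, gapOperator q e x⟫_ℂ).re

end Main

end QGaussian

end

open QGaussian

universe u

/-! Gap. Write `L - R` as a difference of creations plus a difference of annihilations. For a unit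
vector `φ`, the squared norm of `l*_φ x - r*_φ x` is about `2‖x‖² - 2 Re ⟨r*_φ x, l*_φ x⟩`, and `r_φ
l*_φ - l*_φ r_φ` acts on degree `n` as `q ^ n`, so off the vacuum it costs at most `|q| ‖x‖²`. Each
direction thus contributes `(1 - |q|) ‖x‖²`, up to multiples of `‖l_φ x‖²` and `‖r_φ x‖²`. Over an
orthonormal system the gain grows like `d`, whereas `∑ ‖l_{eᵢ} x‖² ≤ (1 - |q|)⁻¹ ‖x‖²` independently
of `d` (`sum_norm_annihilation_sq_le`); hence large `d` gives a gap
(`sum_norm_leftGaussian_sub_rightGaussian_sq_ge`).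

Algebra. Every `R_ψ` commutes with every `L_φ`, hence with `Γ_q`, and `L_φ Ω = R_φ Ω`. Therefore
`(L_φ - R_φ) x Ω = [L_φ, x] Ω` for `x ∈ Γ_q`: almost commuting with the `L_{eᵢ}` means being almost
killed by the `L_{eᵢ} - R_{eᵢ}`, and the gap pushes `x Ω` towards `ℂ Ω`. As `Ω` is separating
(`eq_zero_of_apply_vacuum`), the centre is trivial; the same estimate for unitaries of trace zero
excludes property `Γ`. Traciality holds first against products of the `L_φ` and extends to `Γ_q`
because `x Ω ↦ x* Ω` is isometric (`norm_evalVacuum_star`). -/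

noncomputable section

namespace QGaussian

/-! ### Commutation relations of left and right operators on the Fock space. -/

section FockOperators

variable (q : Set.Ioo (-1 : ℝ) 1) {H : Type*} [NormedAddCommGroup H] [InnerProductSpace ℝ H]

/-- Removing the new first entry gives `⟪φ, ψ⟫`; removing any other entry costs one extra factor
`q`, since its index is shifted by one. The case of two different vectors is what the row estimate
needs. -/
theorem preAnnihilation_preCreation_inner (φ ψ : H) (x : PreFock q H) :
    preAnnihilation q φ (preCreation q ψ x)
      = (⟪φ, ψ⟫_ℝ : ℂ) • x + ((q : ℝ) : ℂ) • preCreation q ψ (preAnnihilation q φ x) := by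
  induction x using preFock_induction q with
  | h0 => simp
  | hadd x y hx hy => simp only [map_add, hx, hy, smul_add]; abel
  | hw c a =>
    simp only [map_smul]
    rw [smul_comm _ c, smul_comm _ c, ← smul_add]
    congr 1
    obtain ⟨n, w⟩ := a
    simp only [preCreation, preAnnihilation, preLift_preWord, consWord, annihilateWord]
    rw [Fin.sum_univ_succ]
    congr 1
    · have e : (Fin.removeNth (α := fun _ => H) 0 (Fin.cons ψ w)) = w := by ext; simp [Fin.removeNth]
      rw [e]
      simp
    · cases n with
      | zero => simp
      | succ n =>
        simp only [map_sum, map_smul, preLift_preWord, Finset.smul_sum]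
        refine Finset.sum_congr rfl fun i _ => ?_
        have e : (Fin.removeNth (α := fun _ => H) i.succ (Fin.cons ψ w))
            = Fin.cons ψ (i.removeNth w) := by
          ext j
          refine Fin.cases ?_ (fun j => ?_) j <;> simp [Fin.removeNth]
        rw [e, smul_smul]
        simp [pow_succ]
        ring_nf

theorem creation_coe (φ : H) (x : PreFock q H) :
    creation q φ (x : Fock q H) = (preCreation q φ x : PreFock q H) := by
  simp [creation]

theorem annihilation_coe (φ : H) (x : PreFock q H) :
    annihilation q φ (x : Fock q H) = (preAnnihilation q φ x : PreFock q H) := by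
  refine ext_inner_left ℂ fun y => ?_
  rw [annihilation, ContinuousLinearMap.adjoint_inner_right]
  induction y using UniformSpace.Completion.induction_on with
  | hp => exact isClosed_eq (by fun_prop) (by fun_prop)
  | ih y => rw [creation_coe, UniformSpace.Completion.inner_coe, UniformSpace.Completion.inner_coe,
      inner_preCreation]

theorem inner_creation_left (φ : H) (x y : Fock q H) :
    ⟪creation q φ x, y⟫_ℂ = ⟪x, annihilation q φ y⟫_ℂ :=
  (ContinuousLinearMap.adjoint_inner_right _ _ _).symm

theorem inner_annihilation_left (φ : H) (x y : Fock q H) :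
    ⟪annihilation q φ x, y⟫_ℂ = ⟪x, creation q φ y⟫_ℂ :=
  ContinuousLinearMap.adjoint_inner_left _ _ _

theorem clm_ext_tensor {S T : Fock q H →L[ℂ] Fock q H}
    (h : ∀ (n : ℕ) (v : Fin n → H), S (tensor q v) = T (tensor q v)) : S = T := by
  ext x
  induction x using UniformSpace.Completion.induction_on with
  | hp => exact isClosed_eq S.continuous T.continuous
  | ih x =>
    induction x using preFock_induction q with
    | h0 => exact (map_zero S).trans (map_zero T).symm
    | hadd x y hx hy => simp only [UniformSpace.Completion.coe_add, map_add, hx, hy]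
    | hw c a =>
      have := h a.1 a.2
      simp only [UniformSpace.Completion.coe_smul, map_smul]
      exact congrArg (c • ·) this

theorem annihilation_tensor_zero (φ : H) (v : Fin 0 → H) : annihilation q φ (tensor q v) = 0 := by
  rw [tensor, annihilation_coe, preAnnihilation, preLift_preWord]
  exact UniformSpace.Completion.coe_zero

theorem tensor_zero_eq (v : Fin 0 → H) : tensor q v = vacuum q H := by
  rw [vacuum]; congr 1; exact Subsingleton.elim _ _

theorem annihilation_vacuum (φ : H) : annihilation q φ (vacuum q H) = 0 :=
  annihilation_tensor_zero q φ _

theorem inner_vacuum_self : ⟪vacuum q H, vacuum q H⟫_ℂ = 1 := by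
  rw [vacuum, inner_tensor]
  simp [tensorForm, invCount]

theorem norm_vacuum : ‖vacuum q H‖ = 1 := by
  have h := inner_self_eq_norm_sq_to_K (𝕜 := ℂ) (vacuum q H)
  rw [inner_vacuum_self] at h
  have h' : ‖vacuum q H‖ ^ 2 = 1 := Complex.ofReal_injective (by push_cast; exact h.symm)
  exact (pow_eq_one_iff_of_nonneg (norm_nonneg _) two_ne_zero).1 h'

theorem reversal_reversal (x : Fock q H) : reversal q H (reversal q H x) = x := by
  have : reversal q H ∘L reversal q H = ContinuousLinearMap.id ℂ _ :=
    clm_ext_tensor q fun n v => by simp [reversal_tensor, Function.comp_def]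
  exact congrArg (fun T : Fock q H →L[ℂ] Fock q H => T x) this

theorem norm_reversal (x : Fock q H) : ‖reversal q H x‖ = ‖x‖ := by
  induction x using UniformSpace.Completion.induction_on with
  | hp => exact isClosed_eq (by fun_prop) (by fun_prop)
  | ih x => simp [reversal, norm_preReversal]

/-- An isometric involution is its own adjoint. -/
theorem adjoint_reversal : (reversal q H).adjoint = reversal q H := by
  refine ContinuousLinearMap.ext fun x => ext_inner_left ℂ fun y => ?_
  rw [ContinuousLinearMap.adjoint_inner_right]
  let U : Fock q H →ₗᵢ[ℂ] Fock q H := ⟨(reversal q H).toLinearMap, norm_reversal q⟩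
  have h := U.inner_map_map y (reversal q H x)
  change ⟪reversal q H y, reversal q H (reversal q H x)⟫_ℂ = _ at h
  rwa [reversal_reversal] at h

theorem rightAnnihilation_eq (φ : H) :
    rightAnnihilation q φ = reversal q H ∘L annihilation q φ ∘L reversal q H := by
  rw [rightAnnihilation, rightCreation, ContinuousLinearMap.adjoint_comp,
    ContinuousLinearMap.adjoint_comp, adjoint_reversal, annihilation]
  rfl

theorem rightGaussian_eq (φ : H) :
    rightGaussian q φ = reversal q H ∘L leftGaussian q φ ∘L reversal q H := by
  ext x
  simp [rightGaussian, leftGaussian, rightAnnihilation_eq, rightCreation]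

theorem inner_rightCreation_left (φ : H) (x y : Fock q H) :
    ⟪rightCreation q φ x, y⟫_ℂ = ⟪x, rightAnnihilation q φ y⟫_ℂ :=
  (ContinuousLinearMap.adjoint_inner_right _ _ _).symm

theorem reversal_vacuum : reversal q H (vacuum q H) = vacuum q H := by
  rw [vacuum, reversal_tensor, tensor_zero_eq, tensor_zero_eq]

theorem isSelfAdjoint_leftGaussian (φ : H) : IsSelfAdjoint (leftGaussian q φ) := by
  rw [leftGaussian, annihilation, add_comm]
  exact IsSelfAdjoint.add_star_self _

theorem isSelfAdjoint_rightGaussian (φ : H) : IsSelfAdjoint (rightGaussian q φ) := by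
  rw [rightGaussian, rightAnnihilation, add_comm]
  exact IsSelfAdjoint.add_star_self _

theorem leftGaussian_vacuum (φ : H) :
    leftGaussian q φ (vacuum q H) = tensor q (fun _ : Fin 1 => φ) := by
  rw [leftGaussian, _root_.add_apply, annihilation_vacuum, zero_add, vacuum,
    creation_tensor]
  congr 1
  ext i
  fin_cases i
  rfl

/-- This identity turns `[L_φ, x] Ω` into `(L_φ - R_φ) x Ω`; it also drives traciality. -/
theorem rightGaussian_vacuum (φ : H) :
    rightGaussian q φ (vacuum q H) = leftGaussian q φ (vacuum q H) := by
  rw [rightGaussian_eq, ContinuousLinearMap.comp_apply, ContinuousLinearMap.comp_apply,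
    reversal_vacuum, leftGaussian_vacuum, reversal_tensor]
  rfl

/-! ### Commutation of left and right operators -/

theorem creation_rightCreation (φ ψ : H) (x : Fock q H) :
    creation q φ (rightCreation q ψ x) = rightCreation q ψ (creation q φ x) := by
  have : creation q φ ∘L rightCreation q ψ = rightCreation q ψ ∘L creation q φ :=
    clm_ext_tensor q fun n v => by
      simp only [ContinuousLinearMap.comp_apply, creation_tensor, rightCreation_tensor]
      rw [Fin.cons_snoc_eq_snoc_cons]
  exact congrArg (fun T : Fock q H →L[ℂ] Fock q H => T x) this

/-- `l_φ` removes either an entry of `v` or the appended `ψ`, which sits at index `n` and so has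
weight `q ^ n`. The commutator is thus a scalar on each degree. -/
theorem annihilation_rightCreation_tensor (φ ψ : H) {n : ℕ} (v : Fin n → H) :
    annihilation q φ (rightCreation q ψ (tensor q v))
      = rightCreation q ψ (annihilation q φ (tensor q v))
        + (((q : ℝ) ^ n * ⟪φ, ψ⟫_ℝ : ℝ) : ℂ) • tensor q v := by
  rw [rightCreation_tensor, annihilation_tensor, Fin.sum_univ_castSucc]
  have hl : Fin.removeNth (α := fun _ => H) (Fin.last n) (Fin.snoc v ψ) = v := by
    ext; simp [Fin.removeNth]
  rw [hl]
  congr 1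
  · cases n with
    | zero => simp [annihilation_tensor_zero]
    | succ n =>
      rw [annihilation_tensor, map_sum]
      refine Finset.sum_congr rfl fun i _ => ?_
      rw [map_smul, rightCreation_tensor]
      have e : Fin.removeNth (α := fun _ => H) i.castSucc (Fin.snoc v ψ)
          = Fin.snoc (i.removeNth v) ψ := by
        ext j
        refine Fin.lastCases ?_ (fun j => ?_) j
        · simp [Fin.removeNth]
        · simp [Fin.removeNth]
      rw [e]
      simp
  · simp

theorem rightAnnihilation_creation_tensor (φ ψ : H) {n : ℕ} (v : Fin n → H) :
    rightAnnihilation q φ (creation q ψ (tensor q v))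
      = creation q ψ (rightAnnihilation q φ (tensor q v))
        + (((q : ℝ) ^ n * ⟪φ, ψ⟫_ℝ : ℝ) : ℂ) • tensor q v := by
  have h := annihilation_rightCreation_tensor q φ ψ (v ∘ Fin.rev)
  have h' := congrArg (reversal q H) h
  rw [rightCreation, ContinuousLinearMap.comp_apply, ContinuousLinearMap.comp_apply,
    reversal_tensor, map_add, map_smul, reversal_tensor] at h'
  simpa [rightAnnihilation_eq, reversal_tensor, reversal_reversal, Function.comp_def] using h'

theorem annihilation_rightAnnihilation (φ ψ : H) (x : Fock q H) :
    annihilation q φ (rightAnnihilation q ψ x) = rightAnnihilation q ψ (annihilation q φ x) := by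
  refine ext_inner_left ℂ fun y => ?_
  rw [← inner_creation_left, ← inner_rightCreation_left, ← inner_rightCreation_left,
    ← inner_creation_left, creation_rightCreation]

/-- The only nonzero commutators, of `l_φ` with `r*_ψ` and of `l*_φ` with `r_ψ`, are `q ^ n ⟪φ, ψ⟫`
with opposite signs in degree `n`, and cancel. -/
theorem leftGaussian_rightGaussian (φ ψ : H) (x : Fock q H) :
    leftGaussian q φ (rightGaussian q ψ x) = rightGaussian q ψ (leftGaussian q φ x) := by
  have : leftGaussian q φ ∘L rightGaussian q ψ = rightGaussian q ψ ∘L leftGaussian q φ :=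
    clm_ext_tensor q fun n v => by
      simp only [leftGaussian, rightGaussian, ContinuousLinearMap.comp_apply,
        _root_.add_apply, map_add, annihilation_rightAnnihilation,
        creation_rightCreation, annihilation_rightCreation_tensor,
        rightAnnihilation_creation_tensor, real_inner_comm φ ψ]
      abel
  exact congrArg (fun T : Fock q H →L[ℂ] Fock q H => T x) this

end FockOperators

/-! ### Bounds on rows of creation operators that do not depend on `d`. -/

section RowEstimate

variable (q : Set.Ioo (-1 : ℝ) 1) {H : Type*} [NormedAddCommGroup H] [InnerProductSpace ℝ H]

theorem one_sub_abs_pos : 0 < 1 - |(q : ℝ)| := by linarith [abs_lt.2 q.2]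

theorem norm_sum_preCreation_sq {d : ℕ} {e : Fin d → H} (he : Orthonormal ℝ e)
    (x : Fin d → PreFock q H) :
    ‖∑ j, preCreation q (e j) (x j)‖ ^ 2 = ∑ j, ‖x j‖ ^ 2
      + q * ∑ i, ∑ j, (⟪preAnnihilation q (e j) (x i), preAnnihilation q (e i) (x j)⟫_ℂ).re := by
  rw [← inner_self_eq_norm_sq (𝕜 := ℂ), sum_inner, Finset.mul_sum, ← Finset.sum_add_distrib,
    map_sum]
  refine Finset.sum_congr rfl fun i _ => ?_
  rw [inner_sum, map_sum, Finset.mul_sum]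
  have hi : ‖x i‖ ^ 2 = ∑ j, if i = j then (⟪x i, x j⟫_ℂ).re else 0 := by
    rw [Finset.sum_ite_eq, if_pos (Finset.mem_univ _)]
    exact (inner_self_eq_norm_sq (𝕜 := ℂ) (x i)).symm
  rw [hi, ← Finset.sum_add_distrib]
  refine Finset.sum_congr rfl fun j _ => ?_
  have hc : ⟪x i, preCreation q (e j) (preAnnihilation q (e i) (x j))⟫_ℂ
      = ⟪preAnnihilation q (e j) (x i), preAnnihilation q (e i) (x j)⟫_ℂ := by
    rw [← inner_conj_symm, inner_preCreation, inner_conj_symm]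
  rw [inner_preCreation, preAnnihilation_preCreation_inner, inner_add_right, inner_smul_right,
    inner_smul_right, hc, (orthonormal_iff_ite.1 he) i j]
  by_cases h : i = j <;> simp [h]

/-- The column `x ↦ (l_{eⱼ} x)ⱼ` is the adjoint of the row `(xⱼ) ↦ ∑ l*_{eⱼ} xⱼ`, so Cauchy–Schwarz
transfers the bound. The row bound is assumed only on the one tuple used, whose degree is lower than
that of `x`; this permits an induction on the degree. -/
theorem sum_norm_preAnnihilation_sq_le_of_row {d : ℕ} (e : Fin d → H) {B : ℝ} (hB : 0 ≤ B)
    (x : PreFock q H)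
    (h : ‖∑ j, preCreation q (e j) (preAnnihilation q (e j) x)‖ ^ 2
      ≤ B * ∑ j, ‖preAnnihilation q (e j) x‖ ^ 2) :
    ∑ j, ‖preAnnihilation q (e j) x‖ ^ 2 ≤ B * ‖x‖ ^ 2 := by
  set s := ∑ j, ‖preAnnihilation q (e j) x‖ ^ 2 with hs
  have hs0 : 0 ≤ s := Finset.sum_nonneg fun _ _ => sq_nonneg _
  have h1 : s = (⟪∑ j, preCreation q (e j) (preAnnihilation q (e j) x), x⟫_ℂ).re := by
    rw [sum_inner, Complex.re_sum, hs]
    refine Finset.sum_congr rfl fun j _ => ?_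
    rw [inner_preCreation]
    exact (inner_self_eq_norm_sq (𝕜 := ℂ) _).symm
  have h2 : s ≤ ‖∑ j, preCreation q (e j) (preAnnihilation q (e j) x)‖ * ‖x‖ :=
    h1.trans_le ((Complex.re_le_norm _).trans (norm_inner_le_norm _ _))
  have h3 : s ^ 2 ≤ (B * ‖x‖ ^ 2) * s := by
    calc s ^ 2 ≤ (‖∑ j, preCreation q (e j) (preAnnihilation q (e j) x)‖ * ‖x‖) ^ 2 := by gcongr
      _ = ‖∑ j, preCreation q (e j) (preAnnihilation q (e j) x)‖ ^ 2 * ‖x‖ ^ 2 := by ring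
      _ ≤ (B * s) * ‖x‖ ^ 2 := by gcongr
      _ = _ := by ring
  rcases hs0.eq_or_lt with h0 | h0
  · rw [← h0]; positivity
  · exact le_of_mul_le_mul_right (by rwa [← sq]) h0

/-- Induction on the degree: a row bound `B` in degree `N` gives the column bound `B` in degree `N +
1`, hence the row bound `1 + |q| B` there. The constant `(1 - |q|)⁻¹` is the fixed point of `B ↦ 1 +
|q| B`. -/
theorem norm_sum_preCreation_sq_le {d : ℕ} {e : Fin d → H} (he : Orthonormal ℝ e) (N : ℕ) :
    ∀ x : Fin d → PreFock q H, (∀ j, x j ∈ degLE q (H := H) N) →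
      ‖∑ j, preCreation q (e j) (x j)‖ ^ 2 ≤ (1 - |(q : ℝ)|)⁻¹ * ∑ j, ‖x j‖ ^ 2 := by
  have hq := one_sub_abs_pos q
  have hB1 : 1 ≤ (1 - |(q : ℝ)|)⁻¹ := (one_le_inv₀ hq).2 (by linarith [abs_nonneg (q : ℝ)])
  have hBq : 1 + |(q : ℝ)| * (1 - |(q : ℝ)|)⁻¹ = (1 - |(q : ℝ)|)⁻¹ := by
    field_simp; ring
  set B := (1 - |(q : ℝ)|)⁻¹ with hB
  have hB0 : 0 ≤ B := zero_le_one.trans hB1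
  induction N with
  | zero =>
    intro x hx
    rw [norm_sum_preCreation_sq q he]
    simp only [fun i j => preAnnihilation_zero q (e i) (hx j), inner_zero_left, Complex.zero_re,
      Finset.sum_const_zero, mul_zero, add_zero]
    exact le_mul_of_one_le_left (Finset.sum_nonneg fun _ _ => sq_nonneg _) hB1
  | succ N ih =>
    intro x hx
    have hcol : ∀ i, ∑ j, ‖preAnnihilation q (e j) (x i)‖ ^ 2 ≤ B * ‖x i‖ ^ 2 := fun i =>
      sum_norm_preAnnihilation_sq_le_of_row q e hB0 _
        (ih _ fun j => preAnnihilation_succ q (e j) (hx i))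
    set S := ∑ i, ∑ j, ‖preAnnihilation q (e j) (x i)‖ ^ 2 with hS
    have hSB : S ≤ B * ∑ i, ‖x i‖ ^ 2 := by
      rw [Finset.mul_sum]
      exact Finset.sum_le_sum fun i _ => hcol i
    -- By `ab ≤ (a² + b²) / 2`: both halves sum to `S`, since exchanging `i` and `j` swaps them.
    have hcross : |∑ i, ∑ j, (⟪preAnnihilation q (e j) (x i),
        preAnnihilation q (e i) (x j)⟫_ℂ).re| ≤ S := by
      have hS2 : S = ∑ i, ∑ j, (‖preAnnihilation q (e j) (x i)‖ ^ 2
          + ‖preAnnihilation q (e i) (x j)‖ ^ 2) / 2 := by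
        have hc : ∑ i, ∑ j, ‖preAnnihilation q (e i) (x j)‖ ^ 2 = S := Finset.sum_comm
        simp only [add_div, Finset.sum_add_distrib, ← Finset.sum_div]
        rw [hc, ← hS]; ring
      rw [hS2]
      refine (Finset.abs_sum_le_sum_abs _ _).trans (Finset.sum_le_sum fun i _ => ?_)
      refine (Finset.abs_sum_le_sum_abs _ _).trans (Finset.sum_le_sum fun j _ => ?_)
      have h1 := (Complex.abs_re_le_norm _).trans (norm_inner_le_norm (𝕜 := ℂ)
        (preAnnihilation q (e j) (x i)) (preAnnihilation q (e i) (x j)))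
      nlinarith [sq_nonneg (‖preAnnihilation q (e j) (x i)‖ - ‖preAnnihilation q (e i) (x j)‖)]
    rw [norm_sum_preCreation_sq q he]
    calc _ ≤ ∑ j, ‖x j‖ ^ 2 + |(q : ℝ)| * S := by
          refine add_le_add_right ((le_abs_self _).trans ?_) _
          rw [abs_mul]
          exact mul_le_mul_of_nonneg_left hcross (abs_nonneg _)
      _ ≤ ∑ j, ‖x j‖ ^ 2 + |(q : ℝ)| * (B * ∑ i, ‖x i‖ ^ 2) := by gcongr
      _ = (1 + |(q : ℝ)| * B) * ∑ j, ‖x j‖ ^ 2 := by ring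
      _ = _ := by rw [hBq]

theorem sum_norm_annihilation_sq_le {d : ℕ} {e : Fin d → H} (he : Orthonormal ℝ e)
    (x : Fock q H) :
    ∑ j, ‖annihilation q (e j) x‖ ^ 2 ≤ (1 - |(q : ℝ)|)⁻¹ * ‖x‖ ^ 2 := by
  induction x using UniformSpace.Completion.induction_on with
  | hp => exact isClosed_le (by fun_prop) (by fun_prop)
  | ih x =>
    simp only [annihilation_coe, UniformSpace.Completion.norm_coe]
    obtain ⟨N, hN⟩ := mem_degLE q x
    refine sum_norm_preAnnihilation_sq_le_of_row q e (inv_nonneg.2 (one_sub_abs_pos q).le) x ?_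
    cases N with
    | zero => simp [preAnnihilation_zero q _ hN]
    | succ N =>
      exact norm_sum_preCreation_sq_le q he N _ fun j => preAnnihilation_succ q (e j) hN

theorem sum_norm_rightAnnihilation_sq_le {d : ℕ} {e : Fin d → H} (he : Orthonormal ℝ e)
    (x : Fock q H) :
    ∑ j, ‖rightAnnihilation q (e j) x‖ ^ 2 ≤ (1 - |(q : ℝ)|)⁻¹ * ‖x‖ ^ 2 := by
  simpa [rightAnnihilation_eq, norm_reversal] using
    sum_norm_annihilation_sq_le q he (reversal q H x)

end RowEstimate

/-! ### Square roots of positive operators. -/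

section PositiveOperators

variable {E : Type*} [NormedAddCommGroup E] [InnerProductSpace ℂ E] [CompleteSpace E]

theorem sum_sq_nonneg_of_isSelfAdjoint {ι : Type*} [Fintype ι] {T : ι → E →L[ℂ] E}
    (hT : ∀ i, IsSelfAdjoint (T i)) : 0 ≤ ∑ i, T i ^ 2 :=
  Finset.sum_nonneg fun i _ => (hT i).sq_nonneg

theorem norm_sqrt_apply_sq {T : E →L[ℂ] E} (hT : 0 ≤ T) (x : E) :
    ‖CFC.sqrt T x‖ ^ 2 = (⟪x, T x⟫_ℂ).re := by
  have hs : IsSelfAdjoint (CFC.sqrt T) := IsSelfAdjoint.of_nonneg (CFC.sqrt_nonneg _)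
  conv_rhs => rw [← CFC.sqrt_mul_sqrt_self T hT, mul_apply_eq_comp,
    ← ContinuousLinearMap.adjoint_inner_left, hs.adjoint_eq]
  exact (inner_self_eq_norm_sq (𝕜 := ℂ) _).symm

/-- For a positive operator `T`, `‖T x‖² ≤ ‖T‖ ⟨x, T x⟩`. -/
theorem norm_apply_sq_le_of_nonneg {T : E →L[ℂ] E} (hT : 0 ≤ T) (x : E) :
    ‖T x‖ ^ 2 ≤ ‖T‖ * (⟪x, T x⟫_ℂ).re := by
  have hs : IsSelfAdjoint (CFC.sqrt T) := IsSelfAdjoint.of_nonneg (CFC.sqrt_nonneg _)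
  have h1 : ‖T‖ = ‖CFC.sqrt T‖ ^ 2 := by
    rw [← hs.norm_mul_self, CFC.sqrt_mul_sqrt_self T hT]
  have h2 : T x = CFC.sqrt T (CFC.sqrt T x) := by
    conv_lhs => rw [← CFC.sqrt_mul_sqrt_self T hT, mul_apply_eq_comp]
  rw [← norm_sqrt_apply_sq hT, h1, h2, ← mul_pow]
  gcongr
  exact (CFC.sqrt T).le_opNorm _

end PositiveOperators

/-! ### The spectral gap of `|M|`. -/

section Gap

variable (q : Set.Ioo (-1 : ℝ) 1) {H : Type*} [NormedAddCommGroup H] [InnerProductSpace ℝ H]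

theorem preWord_fst_eq_zero {a : FockWord H} (h : a.1 = 0) :
    ((preWord q a : PreFock q H) : Fock q H) = vacuum q H := by
  obtain ⟨n, v⟩ := a
  obtain rfl : n = 0 := h
  exact tensor_zero_eq q v

theorem inner_vacuum_preWord {a : FockWord H} (h : a.1 ≠ 0) :
    ⟪vacuum q H, ((preWord q a : PreFock q H) : Fock q H)⟫_ℂ = 0 := by
  rw [vacuum, tensor, UniformSpace.Completion.inner_coe, inner_preWord, wordForm, dif_neg,
    Complex.ofReal_zero]
  exact fun h' => h h'.symm

/-- A linear map `PreFock q H → Fock q H` that scales words by their length `n` as `q ^ n` has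
quadratic form at most `|q|` on the orthogonal complement of the vacuum. -/
theorem re_inner_le_of_scaling {T : Fock q H →L[ℂ] Fock q H}
    (hT : ∀ (n : ℕ) (v : Fin n → H), T (tensor q v) = (((q : ℝ) ^ n : ℝ) : ℂ) • tensor q v)
    {x : Fock q H} (hx : ⟪vacuum q H, x⟫_ℂ = 0) :
    (⟪x, T x⟫_ℂ).re ≤ |(q : ℝ)| * ‖x‖ ^ 2 := by
  -- Diagonal square root of `|q| - T`. Degree `0` is set to `0` because `|q| - q ^ 0` is negative
  -- there.
  let f : FockWord H → ℝ := fun a => if a.1 = 0 then 0 else √(|(q : ℝ)| - q ^ a.1)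
  have hf : ∀ a : FockWord H, a.1 ≠ 0 → f a * f a = |(q : ℝ)| - q ^ a.1 := by
    intro a ha
    simp only [f, if_neg ha]
    refine Real.mul_self_sqrt ?_
    have h1 : (q : ℝ) ^ a.1 ≤ |(q : ℝ)| ^ a.1 := (le_abs_self _).trans (abs_pow _ _).le
    have h2 : |(q : ℝ)| ^ a.1 ≤ |(q : ℝ)| :=
      pow_le_of_le_one (abs_nonneg _) (abs_lt.2 q.2).le ha
    linarith
  let D : PreFock q H →ₗ[ℂ] PreFock q H := preLift q fun a => (f a : ℂ) • preWord q a
  have hD : ∀ x y, ⟪D x, y⟫_ℂ = ⟪x, D y⟫_ℂ := inner_preLift_eq q fun a b => by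
    rw [inner_smul_left, inner_smul_right, inner_preWord, Complex.conj_ofReal]
    by_cases h : a.1 = b.1
    · simp only [f, h]
    · simp [wordForm, h]
  -- `D² = |q| - T + (1 - |q|) P`, with `P` the projection onto the vacuum; the last term corrects
  -- the value of `f` in degree `0`.
  have hDD : ∀ x : PreFock q H, ((D (D x) : PreFock q H) : Fock q H)
      = ((|(q : ℝ)| : ℝ) : ℂ) • (x : Fock q H) - T x
        + ((1 - |(q : ℝ)| : ℝ) : ℂ) • ⟪vacuum q H, (x : Fock q H)⟫_ℂ • vacuum q H := by
    intro x
    induction x using preFock_induction q with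
    | h0 =>
      have h0 : ((0 : PreFock q H) : Fock q H) = 0 := UniformSpace.Completion.coe_zero
      simp only [map_zero, h0, smul_zero, inner_zero_right, zero_smul, sub_zero, add_zero]
    | hadd x y hx hy =>
      simp only [map_add, UniformSpace.Completion.coe_add, hx, hy, inner_add_right, smul_add,
        add_smul]
      abel
    | hw c a =>
      have hTa : T ((preWord q a : PreFock q H) : Fock q H)
          = (((q : ℝ) ^ a.1 : ℝ) : ℂ) • ((preWord q a : PreFock q H) : Fock q H) := hT a.1 a.2
      simp only [map_smul, D, preLift_preWord, UniformSpace.Completion.coe_smul, hTa,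
        inner_smul_right]
      by_cases ha : a.1 = 0
      · have hfa : f a = 0 := by simp only [f, if_pos ha]
        rw [preWord_fst_eq_zero q ha, ha, hfa, inner_vacuum_self]
        push_cast
        module
      · have hfa : (f a : ℂ) * f a = ((|(q : ℝ)| : ℝ) : ℂ) - q ^ a.1 := by
          rw [← Complex.ofReal_mul, hf a ha]; push_cast; ring
        rw [inner_vacuum_preWord q ha, smul_smul (f a : ℂ), hfa]
        push_cast
        module
  -- Keeping the vacuum component makes this a closed condition on all vectors, so it follows by
  -- density from finite combinations of words, where `D` is defined.
  have key : ∀ x : Fock q H, (⟪x, T x⟫_ℂ).re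
      ≤ |(q : ℝ)| * ‖x‖ ^ 2 + (1 - |(q : ℝ)|) * ‖⟪vacuum q H, x⟫_ℂ‖ ^ 2 := by
    intro x
    induction x using UniformSpace.Completion.induction_on with
    | hp =>
      have := T.continuous
      exact isClosed_le (Complex.continuous_re.comp (continuous_id.inner this)) (by fun_prop)
    | ih x =>
      have h1 : 0 ≤ (⟪(x : Fock q H), ((D (D x) : PreFock q H) : Fock q H)⟫_ℂ).re := by
        rw [UniformSpace.Completion.inner_coe, ← hD]
        exact inner_self_nonneg (𝕜 := ℂ)
      have h2 : ⟪(x : Fock q H), (x : Fock q H)⟫_ℂ = ((‖(x : Fock q H)‖ ^ 2 : ℝ) : ℂ) := by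
        rw [inner_self_eq_norm_sq_to_K]; push_cast; rfl
      have h3 : ⟪vacuum q H, (x : Fock q H)⟫_ℂ * ⟪(x : Fock q H), vacuum q H⟫_ℂ
          = ((‖⟪vacuum q H, (x : Fock q H)⟫_ℂ‖ ^ 2 : ℝ) : ℂ) := by
        rw [← inner_conj_symm (x : Fock q H), Complex.mul_conj, Complex.normSq_eq_norm_sq]
      rw [hDD, inner_add_right, inner_sub_right, inner_smul_right, inner_smul_right,
        inner_smul_right, h2, h3, ← Complex.ofReal_mul, ← Complex.ofReal_mul] at h1
      simp only [Complex.add_re, Complex.sub_re, Complex.ofReal_re] at h1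
      linarith
  simpa [hx] using key x

theorem norm_creation_sq (φ : H) (x : Fock q H) :
    ‖creation q φ x‖ ^ 2 = ‖φ‖ ^ 2 * ‖x‖ ^ 2 + q * ‖annihilation q φ x‖ ^ 2 := by
  induction x using UniformSpace.Completion.induction_on with
  | hp => exact isClosed_eq (by fun_prop) (by fun_prop)
  | ih x => simp only [creation_coe, annihilation_coe, UniformSpace.Completion.norm_coe,
      norm_preCreation_sq]

theorem norm_rightCreation_sq (φ : H) (x : Fock q H) :
    ‖rightCreation q φ x‖ ^ 2 = ‖φ‖ ^ 2 * ‖x‖ ^ 2 + q * ‖rightAnnihilation q φ x‖ ^ 2 := by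
  simpa [rightAnnihilation_eq, rightCreation, norm_reversal] using
    norm_creation_sq q φ (reversal q H x)

/-- Move `r*_φ` across and commute: `⟨r*_φ x, l*_φ x⟩ = ⟨l_φ x, r_φ x⟩ + ⟨x, T x⟩`, where `T = r_φ
l*_φ - l*_φ r_φ` scales degree `n` by `q ^ n`. -/
theorem re_inner_rightCreation_creation_le {φ : H} (hφ : ‖φ‖ = 1) {x : Fock q H}
    (hx : ⟪vacuum q H, x⟫_ℂ = 0) :
    (⟪rightCreation q φ x, creation q φ x⟫_ℂ).re
      ≤ (‖annihilation q φ x‖ ^ 2 + ‖rightAnnihilation q φ x‖ ^ 2) / 2 + |(q : ℝ)| * ‖x‖ ^ 2 := by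
  let T : Fock q H →L[ℂ] Fock q H :=
    rightAnnihilation q φ ∘L creation q φ - creation q φ ∘L rightAnnihilation q φ
  have hT := re_inner_le_of_scaling q (T := T) (fun n v => by
    change rightAnnihilation q φ (creation q φ (tensor q v))
      - creation q φ (rightAnnihilation q φ (tensor q v)) = _
    rw [rightAnnihilation_creation_tensor, add_sub_cancel_left, real_inner_self_eq_norm_sq, hφ]
    simp) hx
  have h1 : ⟪rightCreation q φ x, creation q φ x⟫_ℂ
      = ⟪annihilation q φ x, rightAnnihilation q φ x⟫_ℂ + ⟪x, T x⟫_ℂ := by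
    rw [inner_rightCreation_left, inner_annihilation_left, ← inner_add_right]
    congr 1
    change _ = _ + (rightAnnihilation q φ (creation q φ x)
      - creation q φ (rightAnnihilation q φ x))
    abel
  have h2 := (Complex.re_le_norm _).trans (norm_inner_le_norm (𝕜 := ℂ)
    (annihilation q φ x) (rightAnnihilation q φ x))
  rw [h1, Complex.add_re]
  nlinarith [sq_nonneg (‖annihilation q φ x‖ - ‖rightAnnihilation q φ x‖)]

/-- With `p` the creation part and `m` the annihilation part, `‖p + m‖² ≥ ‖p‖² / 2 - ‖m‖²`. The two
terms lose one and two copies of the squared annihilation norms, whence the factor `3`. -/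
theorem norm_leftGaussian_sub_rightGaussian_sq_ge {φ : H} (hφ : ‖φ‖ = 1) {x : Fock q H}
    (hx : ⟪vacuum q H, x⟫_ℂ = 0) :
    (1 - |(q : ℝ)|) * ‖x‖ ^ 2 - 3 * ‖annihilation q φ x‖ ^ 2 - 3 * ‖rightAnnihilation q φ x‖ ^ 2
      ≤ ‖(leftGaussian q φ - rightGaussian q φ) x‖ ^ 2 := by
  set m := annihilation q φ x - rightAnnihilation q φ x with hm
  set p := creation q φ x - rightCreation q φ x with hp
  have hs : (leftGaussian q φ - rightGaussian q φ) x = p + m := by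
    rw [_root_.sub_apply, leftGaussian, rightGaussian, _root_.add_apply, _root_.add_apply, hm, hp]
    abel
  have hm2 : ‖m‖ ^ 2 ≤ 2 * ‖annihilation q φ x‖ ^ 2 + 2 * ‖rightAnnihilation q φ x‖ ^ 2 := by
    have := norm_sub_le (annihilation q φ x) (rightAnnihilation q φ x)
    rw [← hm] at this
    nlinarith [norm_nonneg m,
      sq_nonneg (‖annihilation q φ x‖ - ‖rightAnnihilation q φ x‖)]
  have hpm : ‖p‖ ^ 2 ≤ 2 * ‖p + m‖ ^ 2 + 2 * ‖m‖ ^ 2 := by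
    have := norm_sub_le (p + m) m
    rw [add_sub_cancel_right] at this
    nlinarith [norm_nonneg p, sq_nonneg (‖p + m‖ - ‖m‖)]
  have hq : |(q : ℝ)| ≤ 1 := (abs_lt.2 q.2).le
  have hp2 : 2 * (1 - |(q : ℝ)|) * ‖x‖ ^ 2 - 2 * ‖annihilation q φ x‖ ^ 2
      - 2 * ‖rightAnnihilation q φ x‖ ^ 2 ≤ ‖p‖ ^ 2 := by
    have h1 := norm_sub_sq (𝕜 := ℂ) (rightCreation q φ x) (creation q φ x)
    rw [norm_sub_rev, ← hp, norm_rightCreation_sq, norm_creation_sq, hφ] at h1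
    have h2 := re_inner_rightCreation_creation_le q hφ hx
    have h3 : -(1 : ℝ) ≤ q := q.2.1.le
    change ‖p‖ ^ 2 = _ - 2 * (⟪rightCreation q φ x, creation q φ x⟫_ℂ).re + _ at h1
    nlinarith [sq_nonneg ‖annihilation q φ x‖, sq_nonneg ‖rightAnnihilation q φ x‖]
  rw [hs]
  linarith

theorem sum_norm_leftGaussian_sub_rightGaussian_sq_ge {d : ℕ} {e : Fin d → H}
    (he : Orthonormal ℝ e) {x : Fock q H} (hx : ⟪vacuum q H, x⟫_ℂ = 0) :
    (d * (1 - |(q : ℝ)|) - 6 * (1 - |(q : ℝ)|)⁻¹) * ‖x‖ ^ 2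
      ≤ ∑ i, ‖(leftGaussian q (e i) - rightGaussian q (e i)) x‖ ^ 2 := by
  have h := Finset.sum_le_sum fun i (_ : i ∈ Finset.univ) =>
    norm_leftGaussian_sub_rightGaussian_sq_ge q (he.1 i) hx
  simp only [Finset.sum_sub_distrib, ← Finset.mul_sum, Finset.sum_const, Finset.card_univ,
    Fintype.card_fin, nsmul_eq_mul] at h
  have h1 := sum_norm_annihilation_sq_le q he x
  have h2 := sum_norm_rightAnnihilation_sq_le q he x
  linarith

theorem inner_sum_sq_gaussian {d : ℕ} (e : Fin d → H) (x : Fock q H) :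
    (⟪x, (∑ i, (leftGaussian q (e i) - rightGaussian q (e i)) ^ 2) x⟫_ℂ).re
      = ∑ i, ‖(leftGaussian q (e i) - rightGaussian q (e i)) x‖ ^ 2 := by
  rw [_root_.sum_apply, inner_sum, Complex.re_sum]
  refine Finset.sum_congr rfl fun i _ => ?_
  have hs : IsSelfAdjoint (leftGaussian q (e i) - rightGaussian q (e i)) :=
    (isSelfAdjoint_leftGaussian q _).sub (isSelfAdjoint_rightGaussian q _)
  rw [sq, mul_apply_eq_comp, ← ContinuousLinearMap.adjoint_inner_left,
    hs.adjoint_eq]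
  exact inner_self_eq_norm_sq (𝕜 := ℂ) _

theorem sum_sq_gaussian_nonneg {d : ℕ} (e : Fin d → H) :
    0 ≤ ∑ i, (leftGaussian q (e i) - rightGaussian q (e i)) ^ 2 :=
  sum_sq_nonneg_of_isSelfAdjoint fun _ =>
    (isSelfAdjoint_leftGaussian q _).sub (isSelfAdjoint_rightGaussian q _)

theorem norm_gapOperator_sq {d : ℕ} (e : Fin d → H) (x : Fock q H) :
    ‖gapOperator q e x‖ ^ 2
      = ∑ i, ‖(leftGaussian q (e i) - rightGaussian q (e i)) x‖ ^ 2 := by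
  rw [← inner_sum_sq_gaussian, ← norm_sqrt_apply_sq (sum_sq_gaussian_nonneg q e)]
  rfl

theorem exists_isGapConstant : ∃ d₀ : ℕ, IsGapConstant.{u} q d₀ := by
  have hq := one_sub_abs_pos q
  obtain ⟨d₀, hd₀⟩ := exists_nat_gt (6 * (1 - |(q : ℝ)|)⁻¹ / (1 - |(q : ℝ)|))
  refine ⟨d₀, fun H _ _ _ d e he hd => ?_⟩
  set c := d * (1 - |(q : ℝ)|) - 6 * (1 - |(q : ℝ)|)⁻¹ with hc
  have hc0 : 0 < c := by
    rw [div_lt_iff₀ hq] at hd₀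
    have : (d₀ : ℝ) * (1 - |(q : ℝ)|) ≤ d * (1 - |(q : ℝ)|) := by gcongr
    linarith
  -- From `c ‖x‖² ≤ ‖|M| x‖² ≤ ‖|M|‖ ⟨x, |M| x⟩`; the `+ 1` keeps the denominator positive.
  refine ⟨c / (‖gapOperator q e‖ + 1), by positivity, fun x hx => ?_⟩
  have h1 := sum_norm_leftGaussian_sub_rightGaussian_sq_ge q he hx
  rw [← norm_gapOperator_sq, ← hc] at h1
  have h2 := norm_apply_sq_le_of_nonneg (T := gapOperator q e) (CFC.sqrt_nonneg _) x
  have h3 : 0 ≤ (⟪x, gapOperator q e x⟫_ℂ).re := by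
    by_contra h
    have : ‖gapOperator q e‖ * (⟪x, gapOperator q e x⟫_ℂ).re ≤ 0 :=
      mul_nonpos_of_nonneg_of_nonpos (norm_nonneg _) (not_le.1 h).le
    have hx0 : ‖x‖ ^ 2 ≤ 0 := by nlinarith [sq_nonneg ‖x‖]
    have : x = 0 := by simpa using hx0.antisymm (sq_nonneg _)
    simp [this] at h
  rw [div_mul_eq_mul_div, div_le_iff₀ (by positivity)]
  nlinarith

theorem exists_sum_norm_sq_ge_of_gap {d : ℕ} {e : Fin d → H} {ε : ℝ} (hε : 0 < ε)
    (h : ∀ x : Fock q H, ⟪vacuum q H, x⟫_ℂ = 0 →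
      ε * ‖x‖ ^ 2 ≤ (⟪x, gapOperator q e x⟫_ℂ).re) {x : Fock q H}
    (hx : ⟪vacuum q H, x⟫_ℂ = 0) :
    ε ^ 2 * ‖x‖ ^ 2 ≤ ∑ i, ‖(leftGaussian q (e i) - rightGaussian q (e i)) x‖ ^ 2 := by
  rw [← norm_gapOperator_sq, ← mul_pow]
  gcongr
  have h1 := (h x hx).trans ((Complex.re_le_norm _).trans (norm_inner_le_norm (𝕜 := ℂ) _ _))
  rcases (norm_nonneg x).eq_or_lt with h0 | h0
  · rw [← h0]; simp
  · exact le_of_mul_le_mul_left (by nlinarith) h0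

end Gap

/-! ### Cyclicity of the vacuum. -/

section Cyclicity

variable (q : Set.Ioo (-1 : ℝ) 1) {H : Type*} [NormedAddCommGroup H] [InnerProductSpace ℝ H]

/-- `v₀ ⊗ v' = L_{v₀} v' - l_{v₀} v'`, and the last term is a combination of shorter tensors. `K`
need not be closed. -/
theorem tensor_mem_of_leftGaussian_mem {K : Submodule ℂ (Fock q H)} (hΩ : vacuum q H ∈ K)
    (hL : ∀ (φ : H), ∀ x ∈ K, leftGaussian q φ x ∈ K) (n : ℕ) (v : Fin n → H) :
    tensor q v ∈ K := by
  induction n using Nat.strong_induction_on with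
  | h n ih =>
    cases n with
    | zero => rwa [tensor_zero_eq]
    | succ n =>
      have e : tensor q v = leftGaussian q (v 0) (tensor q (Fin.tail v))
          - annihilation q (v 0) (tensor q (Fin.tail v)) := by
        rw [leftGaussian, _root_.add_apply, creation_tensor, Fin.cons_self_tail,
          add_sub_cancel_left]
      rw [e]
      refine K.sub_mem (hL _ _ (ih n n.lt_succ_self _)) ?_
      cases n with
      | zero => rw [annihilation_tensor_zero]; exact K.zero_mem
      | succ n =>
        rw [annihilation_tensor]
        exact K.sum_mem fun i _ => K.smul_mem _ (ih n (by omega) _)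

theorem tensor_mem_of_rightGaussian_mem {K : Submodule ℂ (Fock q H)} (hΩ : vacuum q H ∈ K)
    (hR : ∀ (φ : H), ∀ x ∈ K, rightGaussian q φ x ∈ K) (n : ℕ) (v : Fin n → H) :
    tensor q v ∈ K := by
  have h := tensor_mem_of_leftGaussian_mem q (K := K.comap (reversal q H).toLinearMap)
    (by simpa [reversal_vacuum] using hΩ) (fun φ x hx => by
      have := hR φ _ hx
      simpa [rightGaussian_eq, reversal_reversal] using this) n (v ∘ Fin.rev)
  simpa [reversal_tensor, Function.comp_def] using h

/-- A closed property that holds on a subspace containing all elementary tensors holds on the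
whole Fock space. -/
theorem fock_induction {K : Submodule ℂ (Fock q H)}
    (hK : ∀ (n : ℕ) (v : Fin n → H), tensor q v ∈ K) {p : Fock q H → Prop}
    (hp : IsClosed {x | p x}) (h : ∀ x ∈ K, p x) (x : Fock q H) : p x := by
  induction x using UniformSpace.Completion.induction_on with
  | hp => exact hp
  | ih x =>
    refine h _ ?_
    induction x using preFock_induction q with
    | h0 => exact K.zero_mem
    | hadd x y hx hy => rw [UniformSpace.Completion.coe_add]; exact K.add_mem hx hy
    | hw c a => rw [UniformSpace.Completion.coe_smul]; exact K.smul_mem _ (hK a.1 a.2)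

theorem inner_tensor_of_ne {n m : ℕ} (h : n ≠ m) (v : Fin n → H) (w : Fin m → H) :
    ⟪tensor q v, tensor q w⟫_ℂ = 0 := by
  rw [tensor, tensor, UniformSpace.Completion.inner_coe, inner_preWord, wordForm, dif_neg h,
    Complex.ofReal_zero]

/-- `l_φ` sends `φ^{⊗ (n+1)}` to `(1 + q + ⋯ + q ^ n) ‖φ‖² φ^{⊗ n}`, and the sum is positive for `q
> -1`. -/
theorem tensor_const_ne_zero {φ : H} (hφ : φ ≠ 0) (n : ℕ) :
    tensor q (fun _ : Fin n => φ) ≠ 0 := by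
  induction n with
  | zero =>
    rw [tensor_zero_eq, ← norm_ne_zero_iff, norm_vacuum]
    exact one_ne_zero
  | succ n ih =>
    intro h
    have h1 : annihilation q φ (tensor q (fun _ : Fin (n + 1) => φ))
        = (((∑ i ∈ Finset.range (n + 1), (q : ℝ) ^ i) * ‖φ‖ ^ 2 : ℝ) : ℂ)
          • tensor q (fun _ : Fin n => φ) := by
      rw [annihilation_tensor, ← Fin.sum_univ_eq_sum_range, Finset.sum_mul, Complex.ofReal_sum,
        Finset.sum_smul]
      refine Finset.sum_congr rfl fun i _ => ?_
      rw [real_inner_self_eq_norm_sq]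
      rfl
    rw [h, map_zero, eq_comm, smul_eq_zero, Complex.ofReal_eq_zero] at h1
    have hs : 0 < ∑ i ∈ Finset.range (n + 1), (q : ℝ) ^ i :=
      geom_sum_pos' (by linarith [q.2.1]) n.succ_ne_zero
    exact h1.elim (by positivity) ih

end Cyclicity

/-! ### The vacuum trace on `Γ_q`. -/

section VonNeumannAlgebra

variable (q : Set.Ioo (-1 : ℝ) 1) {H : Type*} [NormedAddCommGroup H] [InnerProductSpace ℝ H]

theorem leftGaussian_mem (φ : H) : leftGaussian q φ ∈ gaussianVN q H := by
  change _ ∈ StarSubalgebra.centralizer ℂ _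
  rw [StarSubalgebra.mem_centralizer_iff]
  intro g hg
  have h := (StarSubalgebra.mem_centralizer_iff ℂ).1 hg _ ⟨φ, rfl⟩
  have h' := (StarSubalgebra.mem_centralizer_iff ℂ).1 (star_mem hg) _ ⟨φ, rfl⟩
  exact ⟨h.1.symm, h'.1.symm⟩

theorem apply_rightGaussian {x : Fock q H →L[ℂ] Fock q H} (hx : x ∈ gaussianVN q H) (φ : H)
    (ξ : Fock q H) : x (rightGaussian q φ ξ) = rightGaussian q φ (x ξ) := by
  have hR : rightGaussian q φ ∈ StarSubalgebra.centralizer ℂ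
      (Set.range fun φ : H => leftGaussian q φ) := by
    rw [StarSubalgebra.mem_centralizer_iff]
    rintro _ ⟨ψ, rfl⟩
    have h : leftGaussian q ψ * rightGaussian q φ = rightGaussian q φ * leftGaussian q ψ :=
      ContinuousLinearMap.ext fun ξ => leftGaussian_rightGaussian q ψ φ ξ
    refine ⟨h, ?_⟩
    change star (leftGaussian q ψ) * _ = _ * star (leftGaussian q ψ)
    rwa [(isSelfAdjoint_leftGaussian q ψ).star_eq]
  have hc := ((StarSubalgebra.mem_centralizer_iff ℂ).1 hx _ hR).1
  exact (congrArg (fun T : Fock q H →L[ℂ] Fock q H => T ξ) hc).symm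

/-- The vacuum is separating for `Γ_q`. -/
theorem eq_zero_of_apply_vacuum {x : Fock q H →L[ℂ] Fock q H} (hx : x ∈ gaussianVN q H)
    (h : x (vacuum q H) = 0) : x = 0 :=
  -- The kernel of `x` contains `Ω` and is stable under every `R_φ`, so it contains all elementary
  -- tensors.
  clm_ext_tensor q fun n v => tensor_mem_of_rightGaussian_mem q
    (K := LinearMap.ker x.toLinearMap) h (fun φ ξ hξ => by
      have hξ' : x ξ = 0 := hξ
      change x (rightGaussian q φ ξ) = 0
      rw [apply_rightGaussian q hx, hξ', map_zero]) n v

variable (H) in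
/-- The map `x ↦ x Ω` on `Γ_q`. -/
def evalVacuum : (gaussianVN q H).toStarSubalgebra →ₗ[ℂ] Fock q H where
  toFun x := (x : Fock q H →L[ℂ] Fock q H) (vacuum q H)
  map_add' x y := by simp
  map_smul' c x := by simp

theorem inner_evalVacuum (x y : (gaussianVN q H).toStarSubalgebra) :
    ⟪evalVacuum q H x, evalVacuum q H y⟫_ℂ = vacuumState q H (star x * y) :=
  (ContinuousLinearMap.adjoint_inner_right (x : Fock q H →L[ℂ] Fock q H) _ _).symm

theorem vacuumState_apply (x : (gaussianVN q H).toStarSubalgebra) :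
    vacuumState q H x = ⟪vacuum q H, evalVacuum q H x⟫_ℂ := rfl

theorem vacuumState_star (x : (gaussianVN q H).toStarSubalgebra) :
    vacuumState q H (star x) = conj (vacuumState q H x) := by
  have h := inner_evalVacuum q x 1
  rw [mul_one] at h
  rw [← h, vacuumState_apply, inner_conj_symm]
  rfl

theorem vacuumState_star_mul_self (x : (gaussianVN q H).toStarSubalgebra) :
    vacuumState q H (star x * x) = ((‖evalVacuum q H x‖ ^ 2 : ℝ) : ℂ) := by
  rw [← inner_evalVacuum, inner_self_eq_norm_sq_to_K]
  push_cast
  rfl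

variable (H) in
/-- The elements `y` of `Γ_q` with `τ (x y) = τ (y x)` for all `x`. -/
def traceCentralizer : Submodule ℂ (gaussianVN q H).toStarSubalgebra where
  carrier := {y | ∀ x, vacuumState q H (x * y) = vacuumState q H (y * x)}
  add_mem' ha hb x := by simp only [mul_add, add_mul, map_add, ha x, hb x]
  zero_mem' x := by simp
  smul_mem' c y hy x := by simp only [mul_smul_comm, smul_mul_assoc, map_smul, hy x]

theorem star_mem_traceCentralizer {y : (gaussianVN q H).toStarSubalgebra}
    (hy : y ∈ traceCentralizer q H) : star y ∈ traceCentralizer q H := fun x => by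
  have h := congrArg conj (hy (star x))
  rw [← vacuumState_star, ← vacuumState_star, star_mul, star_mul, star_star] at h
  exact h.symm

theorem mul_mem_traceCentralizer {y z : (gaussianVN q H).toStarSubalgebra}
    (hy : y ∈ traceCentralizer q H) (hz : z ∈ traceCentralizer q H) :
    y * z ∈ traceCentralizer q H := fun x => by
  rw [← mul_assoc, hz, ← mul_assoc, hy, mul_assoc]

/-- `⟨Ω, x L_φ Ω⟩ = ⟨Ω, R_φ x Ω⟩ = ⟨R_φ Ω, x Ω⟩ = ⟨Ω, L_φ x Ω⟩`. -/
theorem leftGaussian_mem_traceCentralizer (φ : H) :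
    (⟨leftGaussian q φ, leftGaussian_mem q φ⟩ : (gaussianVN q H).toStarSubalgebra)
      ∈ traceCentralizer q H := fun x => by
  change ⟪vacuum q H, (x : Fock q H →L[ℂ] Fock q H) (leftGaussian q φ (vacuum q H))⟫_ℂ
    = ⟪vacuum q H, leftGaussian q φ ((x : Fock q H →L[ℂ] Fock q H) (vacuum q H))⟫_ℂ
  rw [← rightGaussian_vacuum, apply_rightGaussian q x.2,
    ← ContinuousLinearMap.adjoint_inner_left (rightGaussian q φ),
    ← ContinuousLinearMap.adjoint_inner_left (leftGaussian q φ),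
    (isSelfAdjoint_rightGaussian q φ).adjoint_eq, (isSelfAdjoint_leftGaussian q φ).adjoint_eq,
    rightGaussian_vacuum]

theorem tensor_mem_map_traceCentralizer (n : ℕ) (v : Fin n → H) :
    tensor q v ∈ (traceCentralizer q H).map (evalVacuum q H) := by
  refine tensor_mem_of_leftGaussian_mem q (Submodule.mem_map.2 ⟨1, fun x => ?_, rfl⟩) ?_ n v
  · rw [mul_one, one_mul]
  · rintro φ _ ⟨y, hy, rfl⟩
    exact ⟨_, mul_mem_traceCentralizer q (leftGaussian_mem_traceCentralizer q φ) hy, rfl⟩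

/-- Test `x Ω` against the dense set of `y Ω` with `y` in the trace centralizer: `⟨y Ω, x Ω⟩ = τ(y*
x) = τ(x y*) = ⟨x* Ω, y* Ω⟩` and `‖y* Ω‖ = ‖y Ω‖`. No approximation of `x` by polynomials in the
`L_φ` is needed. -/
theorem norm_evalVacuum_le_star (x : (gaussianVN q H).toStarSubalgebra) :
    ‖evalVacuum q H x‖ ≤ ‖evalVacuum q H (star x)‖ := by
  have key : ∀ ζ : Fock q H, ‖⟪ζ, evalVacuum q H x⟫_ℂ‖ ≤ ‖evalVacuum q H (star x)‖ * ‖ζ‖ := by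
    refine fock_induction q (tensor_mem_map_traceCentralizer q)
      (isClosed_le (by fun_prop) (by fun_prop)) ?_
    rintro _ ⟨y, hy, rfl⟩
    have h1 : ⟪evalVacuum q H y, evalVacuum q H x⟫_ℂ
        = ⟪evalVacuum q H (star x), evalVacuum q H (star y)⟫_ℂ := by
      rw [inner_evalVacuum, inner_evalVacuum, star_star, star_mem_traceCentralizer q hy x]
    have h2 : ‖evalVacuum q H (star y)‖ = ‖evalVacuum q H y‖ := by
      have h := hy (star y)
      have h' := vacuumState_star_mul_self q (star y)
      rw [star_star, ← h, vacuumState_star_mul_self, Complex.ofReal_inj] at h'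
      exact ((sq_eq_sq₀ (norm_nonneg _) (norm_nonneg _)).1 h').symm
    rw [h1, ← h2]
    exact norm_inner_le_norm _ _
  have h := key (evalVacuum q H x)
  rw [inner_self_eq_norm_sq_to_K, norm_pow, RCLike.norm_ofReal, abs_norm, sq] at h
  rcases (norm_nonneg (evalVacuum q H x)).eq_or_lt with h0 | h0
  · rw [← h0]; exact norm_nonneg _
  · exact le_of_mul_le_mul_right h h0

theorem norm_evalVacuum_star (x : (gaussianVN q H).toStarSubalgebra) :
    ‖evalVacuum q H (star x)‖ = ‖evalVacuum q H x‖ :=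
  le_antisymm (by simpa using norm_evalVacuum_le_star q (star x)) (norm_evalVacuum_le_star q x)

theorem vacuumState_mul_comm (x y : (gaussianVN q H).toStarSubalgebra) :
    vacuumState q H (x * y) = vacuumState q H (y * x) := by
  suffices h : ⟪evalVacuum q H (star x), evalVacuum q H y⟫_ℂ
      = ⟪evalVacuum q H (star y), evalVacuum q H x⟫_ℂ by
    simpa only [inner_evalVacuum, star_star] using h
  -- For `|c| = 1` the adjoint of `x* + c y` is `conj c (y* + c x)`, so the isometry matches the
  -- norms that enter the polarization identity.
  have hc : ∀ c : ℂ, ‖c‖ = 1 → ‖evalVacuum q H (star x) + c • evalVacuum q H y‖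
      = ‖evalVacuum q H (star y) + c • evalVacuum q H x‖ := by
    intro c hc
    have hcc : conj c * c = 1 := by rw [Complex.conj_mul', hc]; norm_num
    have e : star (star x + c • y) = conj c • (star y + c • x) := by
      rw [star_add, star_star, star_smul, smul_add, smul_smul, hcc, one_smul, add_comm]
      rfl
    rw [← map_smul, ← map_smul, ← map_add, ← map_add, ← norm_evalVacuum_star, e, map_smul,
      norm_smul, RCLike.norm_conj, hc, one_mul]
  have h1 := hc 1 norm_one
  have h2 := hc (-1) (by rw [norm_neg, norm_one])
  have h3 := hc Complex.I Complex.norm_I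
  have h4 := hc (-Complex.I) (by rw [norm_neg, Complex.norm_I])
  simp only [one_smul, neg_smul, ← sub_eq_add_neg] at h1 h2 h3 h4
  rw [inner_eq_sum_norm_sq_div_four, inner_eq_sum_norm_sq_div_four, RCLike.I_to_complex, h1, h2,
    h3, h4]

theorem isFaithfulNormalTracialState_vacuumState :
    IsFaithfulNormalTracialState (gaussianVN q H) (vacuumState q H) where
  map_one := inner_vacuum_self q
  nonneg x := by
    rw [vacuumState_star_mul_self]
    exact ⟨by rw [Complex.ofReal_re]; positivity, Complex.ofReal_im _⟩
  normal := by
    refine ⟨fun k => if k = 0 then vacuum q H else 0, ?_, fun x => ?_⟩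
    · exact summable_of_ne_finset_zero (s := {0}) fun k hk => by
        simp [show k ≠ 0 by simpa using hk]
    · have h := hasSum_single (f := fun k : ℕ =>
        ⟪(if k = 0 then vacuum q H else 0 : Fock q H), (x : Fock q H →L[ℂ] Fock q H)
          (if k = 0 then vacuum q H else 0)⟫_ℂ) 0 (fun k hk => by simp [hk])
      simpa [vacuumState_apply, evalVacuum] using h
  tracial := vacuumState_mul_comm q
  faithful x hx := by
    rw [vacuumState_star_mul_self, Complex.ofReal_eq_zero, sq_eq_zero_iff, norm_eq_zero] at hx
    exact Subtype.ext (eq_zero_of_apply_vacuum q x.2 hx)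

/-- The powers `φ^{⊗ n}` are nonzero, mutually orthogonal and all of the form `x Ω` with `x ∈ Γ_q`.
-/
theorem not_finiteDimensional_gaussianVN [Nontrivial H] :
    ¬ FiniteDimensional ℂ (gaussianVN q H).toStarSubalgebra := by
  intro hfin
  obtain ⟨φ, hφ⟩ := exists_ne (0 : H)
  have hli : LinearIndependent ℂ fun n : ℕ => tensor q (fun _ : Fin n => φ) :=
    linearIndependent_of_ne_zero_of_inner_eq_zero (tensor_const_ne_zero q hφ)
      fun n m h => inner_tensor_of_ne q h _ _
  have hmem : ∀ n : ℕ, tensor q (fun _ : Fin n => φ) ∈ LinearMap.range (evalVacuum q H) :=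
    fun n => LinearMap.map_le_range (tensor_mem_map_traceCentralizer q n _)
  have hli' : LinearIndependent ℂ fun n : ℕ =>
      (⟨_, hmem n⟩ : LinearMap.range (evalVacuum q H)) :=
    LinearIndependent.of_comp (LinearMap.range (evalVacuum q H)).subtype hli
  exact not_finite_iff_infinite.2 inferInstance hli'.finite

end VonNeumannAlgebra

/-! ### Consequences of the gap: factoriality and failure of property `Γ`. -/

section Spectral

variable (q : Set.Ioo (-1 : ℝ) 1) {H : Type*} [NormedAddCommGroup H] [InnerProductSpace ℝ H]

/-- `∑ᵢ ‖(L_{eᵢ} - R_{eᵢ}) x‖² ≥ c ‖x‖²` on the orthogonal complement of the vacuum, with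
`c > 0`. -/
def HasCommutatorGap {d : ℕ} (e : Fin d → H) : Prop :=
  ∃ c : ℝ, 0 < c ∧ ∀ x : Fock q H, ⟪vacuum q H, x⟫_ℂ = 0 →
    c * ‖x‖ ^ 2 ≤ ∑ i, ‖(leftGaussian q (e i) - rightGaussian q (e i)) x‖ ^ 2

theorem isFactor_of_hasCommutatorGap {d : ℕ} {e : Fin d → H} (h : HasCommutatorGap q e) :
    IsFactor (gaussianVN q H) := by
  intro x hx hx'
  obtain ⟨c, hc, hgap⟩ := h
  set a := ⟪vacuum q H, x (vacuum q H)⟫_ℂ with ha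
  -- A central `x` commutes with both `L_φ` and `R_φ`, which agree on `Ω`.
  have hcomm : ∀ φ : H, (leftGaussian q φ - rightGaussian q φ) (x (vacuum q H)) = 0 := by
    intro φ
    have h1 := VonNeumannAlgebra.mem_commutant_iff.1 hx' _ (leftGaussian_mem q φ)
    have h2 : leftGaussian q φ (x (vacuum q H)) = x (leftGaussian q φ (vacuum q H)) :=
      congrArg (fun T : Fock q H →L[ℂ] Fock q H => T (vacuum q H)) h1
    rw [_root_.sub_apply, h2, ← apply_rightGaussian q hx, rightGaussian_vacuum, sub_self]
  have h0 := hgap (x (vacuum q H) - a • vacuum q H) (by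
    rw [inner_sub_right, inner_smul_right, inner_vacuum_self, mul_one, sub_self])
  have hz : ∀ φ : H, (leftGaussian q φ - rightGaussian q φ) (x (vacuum q H) - a • vacuum q H)
      = 0 := by
    intro φ
    rw [map_sub, hcomm, map_smul, _root_.sub_apply, rightGaussian_vacuum, sub_self, smul_zero,
      sub_zero]
  simp only [hz, norm_zero, ne_eq, OfNat.ofNat_ne_zero, not_false_eq_true, zero_pow,
    Finset.sum_const_zero] at h0
  have hn : ‖x (vacuum q H) - a • vacuum q H‖ ^ 2 ≤ 0 := by
    by_contra hn
    exact absurd h0 (not_le.2 (mul_pos hc (not_le.1 hn)))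
  have hx0 : x (vacuum q H) - a • vacuum q H = 0 := by
    simpa using hn.antisymm (sq_nonneg _)
  refine ⟨a, sub_eq_zero.1 (eq_zero_of_apply_vacuum q (sub_mem hx ?_) hx0)⟩
  exact (gaussianVN q H).toStarSubalgebra.smul_mem (one_mem _) a

theorem not_hasPropertyGamma_of_hasCommutatorGap {d : ℕ} {e : Fin d → H}
    (h : HasCommutatorGap q e) : ¬ HasPropertyGamma (gaussianVN q H) (vacuumState q H) := by
  classical
  intro hΓ
  obtain ⟨c, hc, hgap⟩ := h
  let y : Fin d → (gaussianVN q H).toStarSubalgebra := fun i =>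
    ⟨leftGaussian q (e i), leftGaussian_mem q (e i)⟩
  -- With this tolerance the `d` squared commutator norms add up to at most `d c / (d + 1) < c`,
  -- against the gap `c` at the unit vector `u Ω ⊥ Ω`.
  obtain ⟨u, hu, hu0, hcomm⟩ := hΓ (Finset.univ.image y) (√(c / (d + 1))) (by positivity)
  have hnorm : ‖evalVacuum q H u‖ ^ 2 = 1 := by
    have h1 := vacuumState_star_mul_self q u
    rw [(Unitary.mem_iff.1 hu).1,
      (isFaithfulNormalTracialState_vacuumState q).map_one] at h1
    exact_mod_cast h1.symm
  have hi : ∀ i, ‖(leftGaussian q (e i) - rightGaussian q (e i)) (evalVacuum q H u)‖ ^ 2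
      ≤ c / (d + 1) := by
    intro i
    have h1 := hcomm (y i) (Finset.mem_image_of_mem _ (Finset.mem_univ _))
    have h2 : evalVacuum q H (y i * u - u * y i)
        = (leftGaussian q (e i) - rightGaussian q (e i)) (evalVacuum q H u) := by
      change leftGaussian q (e i) ((u : Fock q H →L[ℂ] Fock q H) (vacuum q H))
        - (u : Fock q H →L[ℂ] Fock q H) (leftGaussian q (e i) (vacuum q H)) = _
      rw [← rightGaussian_vacuum, apply_rightGaussian q u.2]
      rfl
    rw [vacuumState_star_mul_self, Complex.ofReal_re, h2] at h1
    exact (Real.sqrt_lt_sqrt_iff (sq_nonneg _)).1 h1 |>.le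
  have h1 := hgap (evalVacuum q H u) hu0
  have h2 := Finset.sum_le_sum fun i (_ : i ∈ Finset.univ) => hi i
  rw [Finset.sum_const, Finset.card_univ, Fintype.card_fin, nsmul_eq_mul] at h2
  rw [hnorm, mul_one] at h1
  have h3 : d * (c / (d + 1)) < c := by
    rw [mul_div_assoc', div_lt_iff₀ (by positivity)]
    nlinarith
  linarith

theorem hasCommutatorGap_of_isGapConstant {d₀ : ℕ} (hd : IsGapConstant.{u} q d₀) {H : Type u}
    [NormedAddCommGroup H] [InnerProductSpace ℝ H] [CompleteSpace H]
    {e : Fin d₀ → H} (he : Orthonormal ℝ e) : HasCommutatorGap q e := by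
  obtain ⟨ε, hε, h⟩ := hd H d₀ e he le_rfl
  exact ⟨ε ^ 2, by positivity, fun x hx => exists_sum_norm_sq_ge_of_gap q hε h hx⟩

/-- For the empty system `|M| = 0`, which has no gap once a nonzero vector is orthogonal to `Ω`.
Hence `dim H ≥ d₀` forces `H ≠ 0`; for `H = 0` the Fock space is one-dimensional and `Γ_q` is not of
type `II₁`. -/
theorem not_isGapConstant_zero : ¬ IsGapConstant.{u} q 0 := by
  intro h
  let H := EuclideanSpace ℝ PUnit.{u + 1}
  obtain ⟨c, hc, hgap⟩ := hasCommutatorGap_of_isGapConstant q h (H := H)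
    (e := Fin.elim0) ⟨fun i => i.elim0, fun i => i.elim0⟩
  obtain ⟨φ, hφ⟩ := exists_ne (0 : H)
  have h1 := hgap (tensor q fun _ : Fin 1 => φ) (inner_tensor_of_ne q zero_ne_one _ _)
  have h2 : 0 < ‖tensor q fun _ : Fin 1 => φ‖ := norm_pos_iff.2 (tensor_const_ne_zero q hφ 1)
  rw [Finset.univ_eq_empty, Finset.sum_empty] at h1
  exact absurd h1 (not_le.2 (by positivity))

theorem exists_orthonormal_of_le_rank {E : Type*} [NormedAddCommGroup E] [InnerProductSpace ℝ E]
    {n : ℕ} (h : (n : Cardinal) ≤ Module.rank ℝ E) : ∃ e : Fin n → E, Orthonormal ℝ e := by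
  obtain ⟨v, hv⟩ := Module.le_rank_iff.1 h
  exact ⟨_, InnerProductSpace.gramSchmidtNormed_orthonormal hv⟩

end Spectral

end QGaussian

end

theorem theorem1 (q : Set.Ioo (-1 : ℝ) 1) :
    (∃ d₀ : ℕ, IsGapConstant.{u} q d₀) ∧
    ∀ d₀ : ℕ, IsGapConstant.{u} q d₀ →
      ∀ (H : Type u) [NormedAddCommGroup H] [InnerProductSpace ℝ H] [CompleteSpace H],
        (d₀ : Cardinal.{u}) ≤ Module.rank ℝ H →
          IsTypeIIOneFactor (gaussianVN q H) ∧
          IsFaithfulNormalTracialState (gaussianVN q H) (vacuumState q H) ∧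
          ¬ HasPropertyGamma (gaussianVN q H) (vacuumState q H) := by
  refine ⟨exists_isGapConstant q, fun d₀ hd H _ _ _ hrank => ?_⟩
  obtain ⟨e, he⟩ := exists_orthonormal_of_le_rank hrank
  have hgap := hasCommutatorGap_of_isGapConstant q hd he
  have hτ := isFaithfulNormalTracialState_vacuumState q (H := H)
  have hd₀ : d₀ ≠ 0 := by
    rintro rfl
    exact not_isGapConstant_zero q hd
  have : Nontrivial H := ⟨e ⟨0, Nat.pos_of_ne_zero hd₀⟩, 0, he.ne_zero _⟩
  exact ⟨⟨isFactor_of_hasCommutatorGap q hgap, not_finiteDimensional_gaussianVN q, _, hτ⟩, hτ,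
    not_hasPropertyGamma_of_hasCommutatorGap q hgap⟩
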